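/- Let $\lambda,\mu\in\mathbb R$ with $\mu\ge 0$ and $3\lambda+2\mu>0$. Set $\widehat w(\delta,\eta)=\mathcal W(\eta^{1/3},\delta/\eta)$ for $\delta,\eta>0$, where $$\mathcal W(x,y)=x^{-4}\Big(\tfrac18(\lambda+2\mu)y^{-4}+\tfrac12\lambda y^{-2}+\tfrac12(\lambda+\mu)\Big)-x^{-2}\Big(\tfrac14(3\lambda+2\mu)y^{-2}+\tfrac12(3\lambda+2\mu)\Big)+\tfrac38(3\lambda+2\mu)$$ is the Saint Venant–Kirchhoff stored energy, and let $\widehat p_{\rm rad}=\delta^2\partial_\delta\widehat w$, $\widehat p_{\rm tan}=\widehat p_{\rm rad}+\tfrac32\delta\eta\,\partial_\eta\widehat w$. A triple $(\rho,p_{\rm rad},p_{\rm tan})$ of functions on $[0,\infty)$ is a *regular ball* with radius $R>0$ and reference density $\mathcal K>0$ if the interior of $\{r>0:\rho(r)>0\}$ is $(0,R)$; $\rho,p_{\rm rad},p_{\rm tan}\in C^0([0,R])\cap C^1((0,R])$; with $m(r)=4\pi\int_0^r\rho(s)s^2\,ds$, $$\frac{dp_{\rm rad}}{dr}=-\frac2r(p_{\rm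 rad}-p_{\rm tan})-\rho\frac{d\Phi}{dr},\qquad \frac{d\Phi}{dr}=\frac{m}{r^2}\qquad\text{on }(0,R)$$ for some function $\Phi$; $p_{\rm rad},p_{\rm tan}>0$ on $[0,R)$; $p_{\rm rad}(R)=0$; $p_{\rm rad}(0)=p_{\rm tan}(0)$; $\rho=p_{\rm rad}=p_{\rm tan}=0$ on $(R,\infty)$; and on $(0,R)$ the constitutive relations $p_{\rm rad}=\widehat p_{\rm rad}(\delta,\eta)$, $p_{\rm tan}=\widehat p_{\rm tan}(\delta,\eta)$ hold, where $\delta(r)=\rho(r)/\mathcal K$ and $\eta(r)=m(r)/(\tfrac{4\pi}3\mathcal K r^3)$. It is *strongly regular* if moreover $\rho,p_{\rm rad},p_{\rm tan}\in C^1([0,R])$ and $\rho',p_{\rm rad}',p_{\rm tan}'\to0$ as $r\to0^+$. Let $$\Delta_\flat=\Big(\frac{5\lambda+6\mu}{3\lambda+2\mu}\Big)^{3/2}.$$ Then: 1. Every regular ball with reference density $\mathcal K>0$ satisfies $\delta_c:=\rho(0)/\mathcal K>1$. 2. If $\rho_c,\mathcal K>0$, $\delta_c=\rho_c/\mathcal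 K$ and $\partial_\delta\widehat p_{\rm rad}(\delta_c,\delta_c)>0$ (strict hyperbolicity at the center), then $\delta_c<\Delta_\flat$. 3. If $\rho_c,\mathcal K>0$ and $1<\delta_c=\rho_c/\mathcal K<\Delta_\flat$, then $\partial_\delta\widehat p_{\rm rad}(\delta_c,\delta_c)>0$ and there is a strongly regular ball with reference density $\mathcal K$ and $\rho(0)=\rho_c$; it is unique, even among all regular balls with reference density $\mathcal K$ and central density $\rho_c$. With $R$ its radius, for all $r\in(0,R]$, $$\partial_\delta\widehat p_{\rm rad}(\delta(r),\eta(r))>0,\quad \rho(r)<\rho_c,\quad \tfrac{4\pi}3\max(\rho(r),\mathcal K)\,r^3<m(r)<\tfrac{4\pi}3\rho_c r^3.$$ -/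

import Mathlib

open Set Filter Topology

noncomputable section

namespace ElasticBall

/-- Mass enclosed in the ball of radius `r` for a radial mass density `rho`. -/
def mass (rho : ℝ → ℝ) (r : ℝ) : ℝ :=
  4 * Real.pi * ∫ s in (0 : ℝ)..r, rho s * s ^ 2

/-- The relative density `δ(r) = ρ(r) / K`, where `K` is the reference density. -/
def delta (K : ℝ) (rho : ℝ → ℝ) (r : ℝ) : ℝ := rho r / K

/-- The relative mean density `η(r) = m(r) / ((4π/3) K r³)`, for `r > 0`.
(For a density that is continuous at the center it tends to `δ(0)` as `r → 0⁺`.) -/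
def eta (K : ℝ) (rho : ℝ → ℝ) (r : ℝ) : ℝ :=
  mass rho r / (4 * Real.pi / 3 * K * r ^ 3)

/-- The static, spherically symmetric Euler-Poisson system at the radii `0 < r < R`,
with Newtonian potential `Φ`. -/
def SolvesStaticSystem (rho pRad pTan : ℝ → ℝ) (R : ℝ) : Prop :=
  ∃ Phi : ℝ → ℝ, ∀ r ∈ Ioo 0 R,
    HasDerivAt Phi (mass rho r / r ^ 2) r ∧
    HasDerivAt pRad (-(2 / r) * (pRad r - pTan r) - rho r * deriv Phi r) r

/-- `(rho, pRad, pTan)` is a regular static self-gravitating ball of matter of radius `R`.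
Only the values at radii `r ≥ 0` matter. -/
structure IsRegularBall (rho pRad pTan : ℝ → ℝ) (R : ℝ) : Prop where
  radius_pos : 0 < R
  support_eq : interior {r : ℝ | 0 < r ∧ 0 < rho r} = Ioo 0 R
  rho_cont : ContinuousOn rho (Icc 0 R)
  pRad_cont : ContinuousOn pRad (Icc 0 R)
  pTan_cont : ContinuousOn pTan (Icc 0 R)
  rho_C1 : ContDiffOn ℝ 1 rho (Ioc 0 R)
  pRad_C1 : ContDiffOn ℝ 1 pRad (Ioc 0 R)
  pTan_C1 : ContDiffOn ℝ 1 pTan (Ioc 0 R)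
  system : SolvesStaticSystem rho pRad pTan R
  pRad_pos : ∀ r ∈ Ico 0 R, 0 < pRad r
  pTan_pos : ∀ r ∈ Ico 0 R, 0 < pTan r
  pRad_boundary : pRad R = 0
  center_eq : pRad 0 = pTan 0
  vacuum : ∀ r, R < r → rho r = 0 ∧ pRad r = 0 ∧ pTan r = 0

/-- Strongly regular balls: the fields are `C¹` up to the center and their radial derivatives
tend to `0` there. -/
structure IsStronglyRegularBall (rho pRad pTan : ℝ → ℝ) (R : ℝ) : Prop
    extends IsRegularBall rho pRad pTan R where
  rho_C1_closed : ContDiffOn ℝ 1 rho (Icc 0 R)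
  pRad_C1_closed : ContDiffOn ℝ 1 pRad (Icc 0 R)
  pTan_C1_closed : ContDiffOn ℝ 1 pTan (Icc 0 R)
  rho_deriv_center : Tendsto (deriv rho) (𝓝[>] 0) (𝓝 0)
  pRad_deriv_center : Tendsto (deriv pRad) (𝓝[>] 0) (𝓝 0)
  pTan_deriv_center : Tendsto (deriv pTan) (𝓝[>] 0) (𝓝 0)

/-- The pressures are given by the `C¹` constitutive functions `cRad, cTan` of `(δ, η)` in the
interior `(0, R)` of the matter support, where `δ, η > 0`. (By continuity the relations then
hold also in the limits `r → 0` and `r → R`, wherever `δ` and `η` have positive limits.) -/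
structure HasConstitutiveFunctions (cRad cTan : ℝ → ℝ → ℝ) (K : ℝ)
    (rho pRad pTan : ℝ → ℝ) (R : ℝ) : Prop where
  cRad_C1 : ContDiffOn ℝ 1 (fun q : ℝ × ℝ => cRad q.1 q.2) (Ioi 0 ×ˢ Ioi 0)
  cTan_C1 : ContDiffOn ℝ 1 (fun q : ℝ × ℝ => cTan q.1 q.2) (Ioi 0 ×ˢ Ioi 0)
  pRad_eq : ∀ r ∈ Ioo 0 R, pRad r = cRad (delta K rho r) (eta K rho r)
  pTan_eq : ∀ r ∈ Ioo 0 R, pTan r = cTan (delta K rho r) (eta K rho r)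

/-- Radial constitutive function of the hyperelastic material with stored energy `w(δ, η)`:
`δ² ∂_δ w`. -/
def hyperRad (w : ℝ → ℝ → ℝ) (d e : ℝ) : ℝ :=
  d ^ 2 * deriv (fun s => w s e) d

/-- Tangential constitutive function of the hyperelastic material with stored energy `w(δ, η)`:
the radial one plus `(3/2) δ η ∂_η w`. -/
def hyperTan (w : ℝ → ℝ → ℝ) (d e : ℝ) : ℝ :=
  hyperRad w d e + 3 / 2 * d * e * deriv (fun t => w d t) e

/-- The Saint Venant-Kirchhoff stored energy with Lamé coefficients `lam, mu`, in the variables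
`x = η^(1/3)`, `y = δ / η`. -/
def svkW (lam mu x y : ℝ) : ℝ :=
  x ^ (-4 : ℤ) * (1 / 8 * (lam + 2 * mu) * y ^ (-4 : ℤ) + 1 / 2 * lam * y ^ (-2 : ℤ)
      + 1 / 2 * (lam + mu))
    + x ^ (-2 : ℤ) * (-(1 / 4) * (3 * lam + 2 * mu) * y ^ (-2 : ℤ)
      - 1 / 2 * (3 * lam + 2 * mu))
    + 3 / 8 * (3 * lam + 2 * mu)

/-- The Saint Venant-Kirchhoff stored energy as a function of `(δ, η)`. -/
def svkEnergy (lam mu d e : ℝ) : ℝ := svkW lam mu (e ^ (1 / 3 : ℝ)) (d / e)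

/-- Radial constitutive function of the Saint Venant-Kirchhoff material. -/
def svkRad (lam mu : ℝ) : ℝ → ℝ → ℝ := hyperRad (svkEnergy lam mu)

/-- Tangential constitutive function of the Saint Venant-Kirchhoff material. -/
def svkTan (lam mu : ℝ) : ℝ → ℝ → ℝ := hyperTan (svkEnergy lam mu)

/-- Strict hyperbolicity at the state `(δ, η) = (d, e)`: `∂_δ cRad (d, e) > 0`.
At the center of a ball the state is `(δ_c, δ_c)`. -/
def StrictlyHyperbolicAt (cRad : ℝ → ℝ → ℝ) (d e : ℝ) : Prop :=
  0 < deriv (fun s => cRad s e) d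

/-- A regular static self-gravitating Saint Venant-Kirchhoff ball of radius `R` with reference
density `K`. -/
def IsRegularSVKBall (lam mu K : ℝ) (rho pRad pTan : ℝ → ℝ) (R : ℝ) : Prop :=
  IsRegularBall rho pRad pTan R ∧
    HasConstitutiveFunctions (svkRad lam mu) (svkTan lam mu) K rho pRad pTan R

/-- A strongly regular static self-gravitating Saint Venant-Kirchhoff ball of radius `R` with
reference density `K`. -/
def IsStronglyRegularSVKBall (lam mu K : ℝ) (rho pRad pTan : ℝ → ℝ) (R : ℝ) : Prop :=
  IsStronglyRegularBall rho pRad pTan R ∧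
    HasConstitutiveFunctions (svkRad lam mu) (svkTan lam mu) K rho pRad pTan R

/-- The critical value `Δ_♭ = ((5λ + 6μ) / (3λ + 2μ))^(3/2)`. -/
def deltaFlat (lam mu : ℝ) : ℝ :=
  ((5 * lam + 6 * mu) / (3 * lam + 2 * mu)) ^ (3 / 2 : ℝ)

end ElasticBall

end

/-! In terms of the tangential stretch b = η^(-1/3) and the radial stretch a = η^(2/3)/δ, the stored
energy W is a polynomial. The pressures are -∂_a W / b² and -∂_b W / (2ab), and `stretchHyp` = 2
∂_a² W is a positive multiple of ∂_δ p_rad. The center is the isotropic state a = b = β with β =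
δ_c^(-1/3). There positive pressure means β < 1, that is δ_c > 1, and hyperbolicity means (5λ+6μ)β²
> 3λ+2μ, that is δ_c < Δ_♭ (`lt_deltaFlat_iff`).

The definition of mass gives r b' = b(a-b)/a, and pressure balance gives an equation for a'. With w
= (a-b)/r these become b' = `tanField` and w' = -4w/r + `radField` (`solvesStretchSystemAt_iff`).
The singular term has a good sign: the regular solution is w = r v, with v(r) the average ∫₀¹ t⁴
q(tr) dt of the right hand side q.

The region β ≤ b ≤ a is preserved. On it `stretchHyp` only grows, so hyperbolicity at the center
propagates outwards, and `radField` is positive with an upper bound that closes on itself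
(`radField_upper`). Existence follows from a Volterra fixed point for the equations cut off outside
this region (`exists_truncated_profile`). While the radial pressure is nonnegative, a is bounded;
but `radField` is then bounded below, so a - b = r²v grows at least quadratically. The pressure
therefore vanishes at a finite radius (`exists_isStretchProfile`).

For uniqueness, the stretches of any regular ball must enter the same region and satisfy w = O(r),
although only continuity at the center is known. A Grönwall estimate then applies, in which the term
-4w/r helps (`IsInnerProfile.unique`). The final bounds are the inequalities β < b < 1 and b < a
translated back to densities. -/

noncomputable section

namespace ElasticBall

/-! ### Energy, pressures and hyperbolicity in the principal stretches. -/

/-- The Saint Venant-Kirchhoff stored energy in terms of the radial and tangential stretches. -/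
def stretchEnergy (lam mu a b : ℝ) : ℝ :=
  1 / 8 * (lam + 2 * mu) * a ^ 4 + 1 / 2 * lam * a ^ 2 * b ^ 2 + 1 / 2 * (lam + mu) * b ^ 4
    - 1 / 4 * (3 * lam + 2 * mu) * a ^ 2 - 1 / 2 * (3 * lam + 2 * mu) * b ^ 2
    + 3 / 8 * (3 * lam + 2 * mu)

/-- The radial pressure in terms of the radial and tangential stretches. -/
def stretchRad (lam mu a b : ℝ) : ℝ :=
  a / (2 * b ^ 2) * ((3 * lam + 2 * mu) - (lam + 2 * mu) * a ^ 2 - 2 * lam * b ^ 2)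

/-- The tangential pressure in terms of the radial and tangential stretches. -/
def stretchTan (lam mu a b : ℝ) : ℝ :=
  1 / (2 * a) * ((3 * lam + 2 * mu) - lam * a ^ 2 - 2 * (lam + mu) * b ^ 2)

/-- Twice the second derivative of the stored energy with respect to the radial stretch. -/
def stretchHyp (lam mu a b : ℝ) : ℝ :=
  3 * (lam + 2 * mu) * a ^ 2 + 2 * lam * b ^ 2 - (3 * lam + 2 * mu)

/-- The tangential stretch of a state with relative mean density `e`. -/
def tanStretch (e : ℝ) : ℝ := e ^ (-(1 / 3) : ℝ)

/-- The radial stretch of a state with relative density `d` and relative mean density `e`. -/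
def radStretch (d e : ℝ) : ℝ := e * tanStretch e / d

lemma tanStretch_pos {e : ℝ} (he : 0 < e) : 0 < tanStretch e := Real.rpow_pos_of_pos he _

lemma radStretch_pos {d e : ℝ} (hd : 0 < d) (he : 0 < e) : 0 < radStretch d e :=
  div_pos (mul_pos he (tanStretch_pos he)) hd

lemma tanStretch_pow_three {e : ℝ} (he : 0 < e) : tanStretch e ^ 3 = 1 / e := by
  rw [tanStretch, ← Real.rpow_natCast, ← Real.rpow_mul he.le]
  norm_num
  rw [Real.rpow_neg_one]

lemma mul_tanStretch_pow_three {e : ℝ} (he : 0 < e) : e * tanStretch e ^ 3 = 1 := by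
  rw [tanStretch_pow_three he]; field_simp

lemma tanStretch_one_div_pow_three {b : ℝ} (hb : 0 < b) : tanStretch (1 / b ^ 3) = b := by
  have h : (1 / b ^ 3 : ℝ) = b ^ (-3 : ℝ) := by
    rw [Real.rpow_neg hb.le, one_div]; norm_cast
  rw [tanStretch, h, ← Real.rpow_mul hb.le]
  norm_num

lemma radStretch_one_div {a b : ℝ} (ha : 0 < a) (hb : 0 < b) :
    radStretch (1 / (a * b ^ 2)) (1 / b ^ 3) = a := by
  rw [radStretch, tanStretch_one_div_pow_three hb]; field_simp

lemma radStretch_self {d : ℝ} (hd : 0 < d) : radStretch d d = tanStretch d := by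
  rw [radStretch]; field_simp

lemma one_div_radStretch_mul {d e : ℝ} (hd : 0 < d) (he : 0 < e) :
    1 / (radStretch d e * tanStretch e ^ 2) = d := by
  have h := mul_tanStretch_pow_three he
  have hb := tanStretch_pos he
  rw [radStretch]
  have : e * tanStretch e / d * tanStretch e ^ 2 = 1 / d := by
    rw [← h]; ring
  rw [this]; field_simp

/-- Since x = 1/b and y = b/a, the negative powers of x and y combine into monomials in a and b. -/
lemma svkEnergy_eq (lam mu : ℝ) {d e : ℝ} (hd : 0 < d) (he : 0 < e) :
    svkEnergy lam mu d e = stretchEnergy lam mu (radStretch d e) (tanStretch e) := by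
  have hx : 0 < e ^ (1 / 3 : ℝ) := Real.rpow_pos_of_pos he _
  have hb : tanStretch e = (e ^ (1 / 3 : ℝ))⁻¹ := by
    rw [tanStretch, Real.rpow_neg he.le]
  rw [svkEnergy, svkW, stretchEnergy, radStretch, hb]
  generalize e ^ (1 / 3 : ℝ) = x at *
  have e4 (t : ℝ) : t ^ (-4 : ℤ) = (t ^ 4)⁻¹ := by rw [zpow_neg]; norm_cast
  have e2 (t : ℝ) : t ^ (-2 : ℤ) = (t ^ 2)⁻¹ := by rw [zpow_neg]; norm_cast
  rw [e4, e2, e4, e2]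
  field_simp
  ring

lemma hasDerivAt_radStretch_left {d : ℝ} (e : ℝ) (hd : 0 < d) :
    HasDerivAt (fun s => radStretch s e) (-(radStretch d e / d)) d := by
  have h := (hasDerivAt_inv hd.ne').const_mul (e * tanStretch e)
  refine (h.congr_deriv ?_).congr_of_eventuallyEq (Eventually.of_forall fun s => ?_)
  · rw [radStretch]; field_simp
  · simp only [radStretch, div_eq_mul_inv]

lemma hasDerivAt_tanStretch {e : ℝ} (he : 0 < e) :
    HasDerivAt tanStretch (-(tanStretch e / (3 * e))) e := by
  have h := Real.hasDerivAt_rpow_const (x := e) (p := (-(1 / 3) : ℝ)) (Or.inl he.ne')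
  refine h.congr_deriv ?_
  rw [Real.rpow_sub_one he.ne', tanStretch]
  field_simp

lemma hasDerivAt_radStretch_right {d e : ℝ} (hd : 0 < d) (he : 0 < e) :
    HasDerivAt (fun t => radStretch d t) (2 / 3 * radStretch d e / e) e := by
  have h := ((hasDerivAt_id e).mul (hasDerivAt_tanStretch he)).div_const d
  refine h.congr_deriv ?_
  simp only [radStretch, id]
  field_simp
  ring

lemma hasDerivAt_stretchEnergy (lam mu : ℝ) {a b : ℝ → ℝ} {a' b' x : ℝ}
    (ha : HasDerivAt a a' x) (hb : HasDerivAt b b' x) :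
    HasDerivAt (fun s => stretchEnergy lam mu (a s) (b s))
      ((1 / 2 * (lam + 2 * mu) * a x ^ 3 + lam * a x * b x ^ 2
          - 1 / 2 * (3 * lam + 2 * mu) * a x) * a'
        + (lam * a x ^ 2 * b x + 2 * (lam + mu) * b x ^ 3 - (3 * lam + 2 * mu) * b x) * b') x := by
  have h := ((((((ha.pow 4).const_mul (1 / 8 * (lam + 2 * mu))).add
    (((ha.pow 2).mul (hb.pow 2)).const_mul (1 / 2 * lam))).add
    ((hb.pow 4).const_mul (1 / 2 * (lam + mu)))).sub
    ((ha.pow 2).const_mul (1 / 4 * (3 * lam + 2 * mu)))).sub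
    ((hb.pow 2).const_mul (1 / 2 * (3 * lam + 2 * mu)))).add_const (3 / 8 * (3 * lam + 2 * mu))
  refine (h.congr_deriv ?_).congr_of_eventuallyEq (Eventually.of_forall fun s => ?_)
  · simp; ring
  · simp [stretchEnergy]; ring

lemma svkRad_eq (lam mu : ℝ) {d e : ℝ} (hd : 0 < d) (he : 0 < e) :
    svkRad lam mu d e = stretchRad lam mu (radStretch d e) (tanStretch e) := by
  have h := hasDerivAt_stretchEnergy lam mu (hasDerivAt_radStretch_left e hd)
    (hasDerivAt_const d (tanStretch e))
  have h2 : HasDerivAt (fun s => svkEnergy lam mu s e) _ d :=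
    h.congr_of_eventuallyEq ((lt_mem_nhds hd).mono fun s hs => svkEnergy_eq lam mu hs he)
  rw [svkRad, hyperRad, h2.deriv, stretchRad]
  have h1 := one_div_radStretch_mul hd he
  have ha := radStretch_pos hd he
  have hb := tanStretch_pos he
  generalize radStretch d e = a at *
  generalize tanStretch e = b at *
  subst h1
  field_simp
  ring

lemma svkTan_eq (lam mu : ℝ) {d e : ℝ} (hd : 0 < d) (he : 0 < e) :
    svkTan lam mu d e = stretchTan lam mu (radStretch d e) (tanStretch e) := by
  have h := hasDerivAt_stretchEnergy lam mu (hasDerivAt_radStretch_right hd he)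
    (hasDerivAt_tanStretch he)
  have h2 : HasDerivAt (fun s => svkEnergy lam mu d s) _ e :=
    h.congr_of_eventuallyEq ((lt_mem_nhds he).mono fun s hs => svkEnergy_eq lam mu hd hs)
  have h3 := svkRad_eq lam mu hd he
  rw [svkRad] at h3
  rw [svkTan, hyperTan, h3, h2.deriv, stretchTan, stretchRad]
  have h1 := one_div_radStretch_mul hd he
  have ha := radStretch_pos hd he
  have hb := tanStretch_pos he
  generalize radStretch d e = a at *
  generalize tanStretch e = b at *
  subst h1
  field_simp
  ring

lemma contDiffOn_tanStretch :
    ContDiffOn ℝ 1 (fun q : ℝ × ℝ => tanStretch q.2) (Ioi 0 ×ˢ Ioi 0) := by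
  refine ContDiffOn.rpow_const_of_ne contDiff_snd.contDiffOn fun _ hq => ?_
  exact ne_of_gt hq.2

lemma contDiffOn_radStretch :
    ContDiffOn ℝ 1 (fun q : ℝ × ℝ => radStretch q.1 q.2) (Ioi 0 ×ˢ Ioi 0) :=
  (contDiff_snd.contDiffOn.mul contDiffOn_tanStretch).div contDiff_fst.contDiffOn
    fun _ hq => ne_of_gt hq.1

lemma ContDiffOn.stretchRad {E : Type*} [NormedAddCommGroup E] [NormedSpace ℝ E] {s : Set E}
    {a b : E → ℝ} (lam mu : ℝ) (ha : ContDiffOn ℝ 1 a s) (hb : ContDiffOn ℝ 1 b s)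
    (h0 : ∀ x ∈ s, b x ≠ 0) : ContDiffOn ℝ 1 (fun x => stretchRad lam mu (a x) (b x)) s := by
  refine (ha.div (contDiffOn_const.mul (hb.pow 2)) fun x hx => ?_).mul
    ((contDiffOn_const.sub (contDiffOn_const.mul (ha.pow 2))).sub
      (contDiffOn_const.mul (hb.pow 2)))
  have := h0 x hx
  positivity

lemma ContDiffOn.stretchTan {E : Type*} [NormedAddCommGroup E] [NormedSpace ℝ E] {s : Set E}
    {a b : E → ℝ} (lam mu : ℝ) (ha : ContDiffOn ℝ 1 a s) (hb : ContDiffOn ℝ 1 b s)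
    (h0 : ∀ x ∈ s, a x ≠ 0) : ContDiffOn ℝ 1 (fun x => stretchTan lam mu (a x) (b x)) s := by
  refine (contDiffOn_const.div (contDiffOn_const.mul ha) fun x hx => ?_).mul
    ((contDiffOn_const.sub (contDiffOn_const.mul (ha.pow 2))).sub
      (contDiffOn_const.mul (hb.pow 2)))
  have := h0 x hx
  positivity

lemma contDiffOn_svkRad (lam mu : ℝ) :
    ContDiffOn ℝ 1 (fun q : ℝ × ℝ => svkRad lam mu q.1 q.2) (Ioi 0 ×ˢ Ioi 0) :=
  (ContDiffOn.stretchRad lam mu contDiffOn_radStretch contDiffOn_tanStretch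
    fun _ hq => (tanStretch_pos hq.2).ne').congr fun _ hq => svkRad_eq lam mu hq.1 hq.2

lemma contDiffOn_svkTan (lam mu : ℝ) :
    ContDiffOn ℝ 1 (fun q : ℝ × ℝ => svkTan lam mu q.1 q.2) (Ioi 0 ×ˢ Ioi 0) :=
  (ContDiffOn.stretchTan lam mu contDiffOn_radStretch contDiffOn_tanStretch
    fun _ hq => (radStretch_pos hq.1 hq.2).ne').congr fun _ hq => svkTan_eq lam mu hq.1 hq.2

lemma hasDerivAt_stretchRad (lam mu : ℝ) {a b : ℝ → ℝ} {a' b' x : ℝ}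
    (ha : HasDerivAt a a' x) (hb : HasDerivAt b b' x) (h0 : b x ≠ 0) :
    HasDerivAt (fun s => stretchRad lam mu (a s) (b s))
      (-(stretchHyp lam mu (a x) (b x) / (2 * b x ^ 2)) * a'
        + a x / b x ^ 3 * ((lam + 2 * mu) * a x ^ 2 - (3 * lam + 2 * mu)) * b') x := by
  have h := (ha.div ((hb.pow 2).const_mul 2) (by simpa using h0)).mul
    ((((ha.pow 2).const_mul (lam + 2 * mu)).const_sub (3 * lam + 2 * mu)).sub
      ((hb.pow 2).const_mul (2 * lam)))
  refine h.congr_deriv ?_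
  simp only [stretchHyp, Pi.pow_apply, Pi.div_apply, Pi.sub_apply]
  field_simp
  push_cast
  ring

/-- At fixed η the tangential stretch is constant and ∂_δ a = -a/δ, so ∂_δ p_rad is `stretchHyp`
times the positive factor a/(2b²δ). -/
lemma strictlyHyperbolicAt_iff (lam mu : ℝ) {d e : ℝ} (hd : 0 < d) (he : 0 < e) :
    StrictlyHyperbolicAt (svkRad lam mu) d e ↔
      0 < stretchHyp lam mu (radStretch d e) (tanStretch e) := by
  have hb := tanStretch_pos he
  have ha := radStretch_pos hd he
  have h := hasDerivAt_stretchRad lam mu (hasDerivAt_radStretch_left e hd)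
    (hasDerivAt_const d (tanStretch e)) hb.ne'
  have h2 : HasDerivAt (fun s => svkRad lam mu s e) _ d :=
    h.congr_of_eventuallyEq ((lt_mem_nhds hd).mono fun s hs => svkRad_eq lam mu hs he)
  rw [StrictlyHyperbolicAt, h2.deriv]
  have : -(stretchHyp lam mu (radStretch d e) (tanStretch e) / (2 * tanStretch e ^ 2)) *
      -(radStretch d e / d) + radStretch d e / tanStretch e ^ 3 *
        ((lam + 2 * mu) * radStretch d e ^ 2 - (3 * lam + 2 * mu)) * 0
      = stretchHyp lam mu (radStretch d e) (tanStretch e)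
        * (radStretch d e / (2 * tanStretch e ^ 2 * d)) := by
    field_simp; ring
  rw [this, mul_pos_iff_of_pos_right (by positivity)]

/-- With β = `tanStretch d` one has d = (β⁻²)^(3/2), so removing the power 3/2 leaves β⁻² <
(5λ+6μ)/(3λ+2μ). The numerator is positive because it equals (5/3)(3λ+2μ) + (8/3)μ. -/
lemma lt_deltaFlat_iff {lam mu : ℝ} (hmu : 0 ≤ mu) (hbulk : 0 < 3 * lam + 2 * mu) {d : ℝ}
    (hd : 0 < d) :
    d < deltaFlat lam mu ↔ 0 < stretchHyp lam mu (tanStretch d) (tanStretch d) := by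
  have hb := tanStretch_pos hd
  have hq : 0 < (5 * lam + 6 * mu) / (3 * lam + 2 * mu) := div_pos (by linarith) hbulk
  have hd2 : d = ((tanStretch d ^ 2)⁻¹) ^ (3 / 2 : ℝ) := by
    have h3 : ((tanStretch d)⁻¹ ^ (2 : ℝ)) ^ (3 / 2 : ℝ) = (tanStretch d)⁻¹ ^ (3 : ℝ) := by
      rw [← Real.rpow_mul (by positivity)]; norm_num
    have h4 : (tanStretch d)⁻¹ ^ (3 : ℝ) = d := by
      have := tanStretch_pow_three hd
      rw [show (3 : ℝ) = ((3 : ℕ) : ℝ) by norm_num, Real.rpow_natCast, inv_pow, this]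
      field_simp
    rw [h4, Real.rpow_two, inv_pow] at h3
    exact h3.symm
  rw [deltaFlat]
  nth_rewrite 1 [hd2]
  rw [Real.rpow_lt_rpow_iff (by positivity) hq.le (by norm_num), lt_div_iff₀ hbulk,
    inv_mul_lt_iff₀ (by positivity), stretchHyp]
  constructor <;> intro h <;> linarith

lemma tanStretch_lt_one_iff {d : ℝ} (hd : 0 < d) : tanStretch d < 1 ↔ 1 < d := by
  have h := mul_tanStretch_pow_three hd
  have hb := tanStretch_pos hd
  constructor
  · intro h1
    have : tanStretch d ^ 3 < 1 := pow_lt_one₀ hb.le h1 (by norm_num)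
    nlinarith
  · intro h1
    by_contra! h2
    have : 1 ≤ tanStretch d ^ 3 := one_le_pow₀ h2
    nlinarith

/-! ### Fixed points for equations with a regular singular point at the center. -/

/-- A self-map of `C([0, Z], E)` which satisfies a Volterra type Lipschitz bound has a fixed
point. -/
lemma exists_fixedPoint_of_volterra {E : Type*} [NormedAddCommGroup E] [CompleteSpace E]
    {Z Λ : ℝ} (hZ : 0 ≤ Z) (hΛ : 0 ≤ Λ) (T : C(Icc 0 Z, E) → C(Icc 0 Z, E))
    (hT : ∀ x y (r : Icc 0 Z), ‖T x r - T y r‖ ≤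
      Λ * ∫ s in (0 : ℝ)..r, ‖x (projIcc 0 Z hZ s) - y (projIcc 0 Z hZ s)‖) :
    ∃ x, T x = x := by
  -- Iterating the Volterra bound produces (Λr)ⁿ/n!, so some iterate of `T` is a contraction without
  -- any smallness of Λ or Z.
  have key : ∀ (n : ℕ) (x y : C(Icc 0 Z, E)) (r : Icc 0 Z),
      ‖T^[n] x r - T^[n] y r‖ ≤ (Λ * r) ^ n / n.factorial * dist x y := by
    intro n
    induction n with
    | zero =>
      intro x y r
      simpa [dist_eq_norm] using ContinuousMap.dist_apply_le_dist (f := x) (g := y) r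
    | succ n ih =>
      intro x y r
      rw [Function.iterate_succ_apply', Function.iterate_succ_apply']
      refine (hT _ _ r).trans ?_
      have h1 : ∫ s in (0 : ℝ)..r, ‖T^[n] x (projIcc 0 Z hZ s) - T^[n] y (projIcc 0 Z hZ s)‖
          ≤ ∫ s in (0 : ℝ)..r, (Λ ^ n / n.factorial * dist x y) * s ^ n := by
        refine intervalIntegral.integral_mono_on r.2.1 ?_ ?_ fun s hs => ?_
        · exact (by fun_prop : Continuous fun s : ℝ =>
            ‖T^[n] x (projIcc 0 Z hZ s) - T^[n] y (projIcc 0 Z hZ s)‖).intervalIntegrable _ _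
        · exact (by fun_prop : Continuous fun s : ℝ =>
            (Λ ^ n / n.factorial * dist x y) * s ^ n).intervalIntegrable _ _
        · have hs' : s ∈ Icc 0 Z := ⟨hs.1, hs.2.trans r.2.2⟩
          refine (ih x y _).trans_eq ?_
          rw [projIcc_of_mem hZ hs', mul_pow]
          ring
      refine (mul_le_mul_of_nonneg_left h1 hΛ).trans_eq ?_
      rw [intervalIntegral.integral_const_mul, integral_pow, Nat.factorial_succ]
      push_cast
      have : (n.factorial : ℝ) ≠ 0 := by positivity
      field_simp
      simp
      ring
  have hlim := FloorSemiring.tendsto_pow_div_factorial_atTop (Λ * Z)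
  obtain ⟨n, hn⟩ := (hlim.eventually (gt_mem_nhds one_half_pos)).exists
  have hc : ContractingWith (1 / 2) T^[n] := by
    refine ⟨by rw [← NNReal.coe_lt_coe]; norm_num, LipschitzWith.of_dist_le_mul fun x y => ?_⟩
    rw [ContinuousMap.dist_le (by positivity)]
    intro r
    rw [dist_eq_norm]
    refine (key n x y r).trans ?_
    refine mul_le_mul_of_nonneg_right ?_ dist_nonneg
    have h1 : (Λ * r) ^ n / n.factorial ≤ (Λ * Z) ^ n / n.factorial := by
      have := r.2.1
      have := r.2.2
      gcongr
    have h2 : ((1 / 2 : NNReal) : ℝ) = 1 / 2 := by norm_num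
    rw [h2]
    exact h1.trans hn.le
  have : Nonempty C(Icc 0 Z, E) := ⟨0⟩
  exact ⟨_, hc.isFixedPt_fixedPoint_iterate⟩

/-- Solvability of `w' = -4 w / r + F₁(r, w, b)`, `b' = F₂(r, w, b)`, `w(0) = 0`, `b(0) = β`, for
globally Lipschitz right hand sides; the solution is written as `w = r v`. -/
lemma exists_singular_solution {Z Λ : ℝ} (hZ : 0 ≤ Z) (hΛ : 0 ≤ Λ) (β : ℝ)
    (F₁ F₂ : ℝ × (ℝ × ℝ) → ℝ) (hF₁ : Continuous F₁) (hF₂ : Continuous F₂)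
    (hL₁ : ∀ r x y, |F₁ (r, x) - F₁ (r, y)| ≤ Λ * ‖x - y‖)
    (hL₂ : ∀ r x y, |F₂ (r, x) - F₂ (r, y)| ≤ Λ * ‖x - y‖) :
    ∃ v b q₁ q₂ : ℝ → ℝ, Continuous q₁ ∧ Continuous q₂ ∧
      (∀ r, v r = ∫ t in (0 : ℝ)..1, t ^ 4 * q₁ (t * r)) ∧
      (∀ r, b r = β + ∫ s in (0 : ℝ)..r, q₂ s) ∧
      ∀ r ∈ Icc 0 Z, q₁ r = F₁ (r, (r * v r, b r)) ∧ q₂ r = F₂ (r, (r * v r, b r)) := by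
  let X := C(Icc 0 Z, ℝ × ℝ)
  let G₁ : X → ℝ → ℝ := fun x s => F₁ (s, x (projIcc 0 Z hZ s))
  let G₂ : X → ℝ → ℝ := fun x s => F₂ (s, x (projIcc 0 Z hZ s))
  have hG₁ : ∀ x, Continuous (G₁ x) := fun x => by fun_prop
  have hG₂ : ∀ x, Continuous (G₂ x) := fun x => by fun_prop
  have hv : ∀ x, Continuous fun r : ℝ => ∫ t in (0 : ℝ)..1, t ^ 4 * G₁ x (t * r) := fun x => by
    have := hG₁ x
    refine intervalIntegral.continuous_parametric_intervalIntegral_of_continuous ?_ continuous_const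
    fun_prop
  have hb : ∀ x, Continuous fun r : ℝ => ∫ s in (0 : ℝ)..r, G₂ x s := fun x =>
    intervalIntegral.continuous_primitive (fun a b => (hG₂ x).intervalIntegrable a b) 0
  -- The unknown is the pair (w, b). Integrating (r⁴w)' = r⁴F₁ from the center and rescaling s = tr
  -- gives w = r ∫₀¹ t⁴ F₁, which has no singularity at r = 0.
  let T : X → X := fun x =>
    ⟨fun r => ((r : ℝ) * ∫ t in (0 : ℝ)..1, t ^ 4 * G₁ x (t * r), β + ∫ s in (0 : ℝ)..r, G₂ x s),
      by
        refine Continuous.prodMk ?_ ?_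
        · exact continuous_subtype_val.mul ((hv x).comp continuous_subtype_val)
        · exact continuous_const.add ((hb x).comp continuous_subtype_val)⟩
  obtain ⟨x, hx⟩ := exists_fixedPoint_of_volterra hZ hΛ T (by
    intro x y r
    have hr := r.2.1
    set D : ℝ → ℝ := fun s => ‖x (projIcc 0 Z hZ s) - y (projIcc 0 Z hZ s)‖ with hD
    have hDc : Continuous D := by fun_prop
    have hx1 := hG₁ x
    have hy1 := hG₁ y
    have hx2 := hG₂ x
    have hy2 := hG₂ y
    rw [Prod.norm_def]
    refine max_le ?_ ?_
    · change |(r : ℝ) * (∫ t in (0 : ℝ)..1, t ^ 4 * G₁ x (t * r))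
        - r * ∫ t in (0 : ℝ)..1, t ^ 4 * G₁ y (t * r)| ≤ _
      rw [← mul_sub, ← intervalIntegral.integral_sub
        ((by fun_prop : Continuous fun t : ℝ => t ^ 4 * G₁ x (t * r)).intervalIntegrable _ _)
        ((by fun_prop : Continuous fun t : ℝ => t ^ 4 * G₁ y (t * r)).intervalIntegrable _ _),
        abs_mul, abs_of_nonneg hr]
      have h1 : |∫ t in (0 : ℝ)..1, (t ^ 4 * G₁ x (t * r) - t ^ 4 * G₁ y (t * r))| ≤
          ∫ t in (0 : ℝ)..1, Λ * D (t * r) := by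
        rw [← Real.norm_eq_abs]
        refine intervalIntegral.norm_integral_le_of_norm_le zero_le_one
          (Eventually.of_forall fun t ht => ?_)
          ((by fun_prop : Continuous fun t : ℝ => Λ * D (t * r)).intervalIntegrable _ _)
        rw [← mul_sub, Real.norm_eq_abs, abs_mul]
        have h4 : |t ^ 4| ≤ 1 := by
          rw [abs_of_nonneg (by positivity)]
          exact pow_le_one₀ ht.1.le ht.2
        refine (mul_le_of_le_one_left (abs_nonneg _) h4).trans (hL₁ _ _ _)
      refine (mul_le_mul_of_nonneg_left h1 hr).trans_eq ?_
      -- After t⁴ ≤ 1, the substitution s = tr absorbs the prefactor r and yields the Volterra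
      -- bound.
      rw [intervalIntegral.integral_const_mul]
      have h2 := intervalIntegral.mul_integral_comp_mul_right (f := D) (a := 0) (b := 1) (r : ℝ)
      simp only [zero_mul, one_mul] at h2
      rw [← h2]
      ring
    · change |(β + ∫ s in (0 : ℝ)..r, G₂ x s) - (β + ∫ s in (0 : ℝ)..r, G₂ y s)| ≤ _
      rw [add_sub_add_left_eq_sub, ← intervalIntegral.integral_sub
        (hx2.intervalIntegrable _ _) (hy2.intervalIntegrable _ _),
        ← intervalIntegral.integral_const_mul, ← Real.norm_eq_abs]
      refine intervalIntegral.norm_integral_le_of_norm_le hr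
          (Eventually.of_forall fun t _ =>
            hL₂ t (x (projIcc 0 Z hZ t)) (y (projIcc 0 Z hZ t)))
          ((by fun_prop : Continuous fun t : ℝ => Λ * D t).intervalIntegrable _ _))
  refine ⟨fun r => ∫ t in (0 : ℝ)..1, t ^ 4 * G₁ x (t * r), fun r => β + ∫ s in (0 : ℝ)..r, G₂ x s,
    G₁ x, G₂ x, hG₁ x, hG₂ x, fun r => rfl, fun r => rfl, fun r hr => ?_⟩
  have h1 : x (projIcc 0 Z hZ r) = T x ⟨r, hr⟩ := by rw [hx, projIcc_of_mem hZ hr]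
  exact ⟨congrArg (fun p => F₁ (r, p)) h1, congrArg (fun p => F₂ (r, p)) h1⟩

/-- This is the derivative of a - b = r²v. Away from 0 it comes from r⁵v = ∫₀ʳ t⁴q; at 0 continuity
of v suffices, because of the factor r². -/
lemma hasDerivAt_sq_mul_average {q v : ℝ → ℝ} (hq : Continuous q)
    (hv : ∀ r, v r = ∫ t in (0 : ℝ)..1, t ^ 4 * q (t * r)) (r : ℝ) :
    HasDerivAt (fun s => s ^ 2 * v s) (r * (q r - 3 * v r)) r := by
  have hvc : Continuous v := by
    rw [show v = fun r => ∫ t in (0 : ℝ)..1, t ^ 4 * q (t * r) from funext hv]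
    refine intervalIntegral.continuous_parametric_intervalIntegral_of_continuous ?_ continuous_const
    fun_prop
  rcases eq_or_ne r 0 with rfl | hr
  · rw [hasDerivAt_iff_tendsto_slope]
    have h1 : Tendsto (fun s => s * v s) (𝓝[≠] 0) (𝓝 (0 * (q 0 - 3 * v 0))) := by
      have : Continuous fun s => s * v s := by fun_prop
      have := this.tendsto 0
      rw [zero_mul] at this ⊢
      exact this.mono_left nhdsWithin_le_nhds
    refine h1.congr' ?_
    filter_upwards [self_mem_nhdsWithin] with s hs
    have hs : s ≠ 0 := hs
    rw [slope_def_field]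
    field_simp
    ring
  · have h5 : ∀ s, s ^ 5 * v s = ∫ t in (0 : ℝ)..s, t ^ 4 * q t := by
      intro s
      have h2 := intervalIntegral.mul_integral_comp_mul_right
        (f := fun t => t ^ 4 * q t) (a := 0) (b := 1) s
      simp only [zero_mul, one_mul] at h2
      rw [← h2, hv]
      have : ∀ t : ℝ, (t * s) ^ 4 * q (t * s) = s ^ 4 * (t ^ 4 * q (t * s)) := fun t => by ring
      simp_rw [this]
      rw [intervalIntegral.integral_const_mul]
      ring
    have hd : HasDerivAt (fun s => s ^ 5 * v s) (r ^ 4 * q r) r := by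
      rw [funext h5]
      have hc : Continuous fun t => t ^ 4 * q t := by fun_prop
      exact intervalIntegral.integral_hasDerivAt_right (hc.intervalIntegrable _ _)
        (hc.stronglyMeasurableAtFilter _ _) hc.continuousAt
    have h3 := hd.div (hasDerivAt_pow 3 r) (pow_ne_zero 3 hr)
    refine (h3.congr_deriv ?_).congr_of_eventuallyEq ?_
    · push_cast
      field_simp
    · filter_upwards [eventually_ne_nhds hr] with s hs
      simp only [Pi.div_apply]
      field_simp

/-! ### The static equations as a system for ((a-b)/r, b), and bounds on its right hand side. -/

/-- The static equations at the radius `r`, with the constitutive relations inserted, for stretches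
`a, b` with radial derivatives `a', b'`. -/
structure SolvesStretchSystemAt (lam mu c r a b a' b' : ℝ) : Prop where
  tan_eq : r * b' = b * (a - b) / a
  rad_eq : r * a' * stretchHyp lam mu a b = 2 * c * r ^ 2 / (a * b ^ 3) + 2 * b * (a - b) *
    ((3 * lam + 2 * mu) - (lam + 2 * mu) * a ^ 2 - 2 * (lam + mu) * (a * b + b ^ 2)) / a

/-- The right hand side of the equation `b' = tanField r w b`, where `w = (a - b) / r`. -/
def tanField (r w b : ℝ) : ℝ := w * b / (b + r * w)

/-- The right hand side of the equation `w' = -4 w / r + radField r w b`, where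
`w = (a - b) / r`. -/
def radField (lam mu c r w b : ℝ) : ℝ :=
  2 * c / ((b + r * w) * b ^ 3 * stretchHyp lam mu (b + r * w) b)
    + w ^ 2 * (3 / (b + r * w)
      + 4 * b * ((lam + 2 * mu) * (b + r * w) + mu * b)
        / ((b + r * w) * stretchHyp lam mu (b + r * w) b))

section Algebra

variable {lam mu c β : ℝ}

/-- The terms of first order in w = (a-b)/r collapse to -3w whatever the Lamé coefficients are; the
rest is r times a field that is smooth up to r = 0. In terms of w' the coefficient becomes -4/r,
because a' - b' = w + r w'. -/
lemma solvesStretchSystemAt_iff {r a b a' b' : ℝ} (hr : r ≠ 0) (ha : a ≠ 0) (hb : b ≠ 0)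
    (hW : stretchHyp lam mu a b ≠ 0) :
    SolvesStretchSystemAt lam mu c r a b a' b' ↔
      b' = tanField r ((a - b) / r) b ∧
      a' - b' = r * radField lam mu c r ((a - b) / r) b - 3 * ((a - b) / r) := by
  have e : b + r * ((a - b) / r) = a := by field_simp; ring
  have key : r * a' * stretchHyp lam mu a b - (2 * c * r ^ 2 / (a * b ^ 3) + 2 * b * (a - b) *
      ((3 * lam + 2 * mu) - (lam + 2 * mu) * a ^ 2 - 2 * (lam + mu) * (a * b + b ^ 2)) / a)
      = r * stretchHyp lam mu a b * (a' - tanField r ((a - b) / r) b -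
        (r * radField lam mu c r ((a - b) / r) b - 3 * ((a - b) / r))) := by
    rw [radField, tanField, e]
    obtain ⟨W, hWe⟩ : ∃ W, W = stretchHyp lam mu a b := ⟨_, rfl⟩
    rw [← hWe] at hW ⊢
    -- Eliminating 3λ+2μ in favour of the hyperbolicity function W turns the claim into a rational
    -- identity with W as a free variable.
    have hB : 3 * lam + 2 * mu = 3 * (lam + 2 * mu) * a ^ 2 + 2 * lam * b ^ 2 - W := by
      rw [hWe, stretchHyp]; ring
    rw [hB]
    field_simp
    ring
  constructor
  · rintro ⟨h1, h2⟩
    have h3 : b' = tanField r ((a - b) / r) b := by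
      have h4 : r * b' * a = b * (a - b) := by rw [h1]; field_simp
      rw [tanField, e]
      field_simp
      linarith
    refine ⟨h3, ?_⟩
    rw [sub_eq_zero.mpr h2] at key
    have h4 := (mul_eq_zero.mp key.symm).resolve_left (mul_ne_zero hr hW)
    rw [h3]
    linarith
  · rintro ⟨h1, h2⟩
    refine ⟨?_, ?_⟩
    · rw [h1, tanField, e]; field_simp
    · rw [← sub_eq_zero, key, ← h1]
      rw [h2]; ring

/-- The difference is 3(λ+2μ)(a²-b²) + (5λ+6μ)(b²-β²), and both coefficients are positive. This
carries hyperbolicity from the center outwards. -/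
lemma stretchHyp_mono (hmu : 0 ≤ mu) (hbulk : 0 < 3 * lam + 2 * mu) {a b : ℝ} (hβ : 0 < β)
    (hb : β ≤ b) (ha : b ≤ a) : stretchHyp lam mu β β ≤ stretchHyp lam mu a b := by
  have h1 : b ^ 2 ≤ a ^ 2 := by gcongr; linarith
  have h2 : β ^ 2 ≤ b ^ 2 := by gcongr
  have h3 : 0 < lam + 2 * mu := by linarith
  rw [stretchHyp, stretchHyp]
  nlinarith

lemma radField_lower (hmu : 0 ≤ mu) (hbulk : 0 < 3 * lam + 2 * mu) (hβ : 0 < β)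
    (hyp : 0 < stretchHyp lam mu β β) {r w b : ℝ} (hr : 0 ≤ r) (hw : 0 ≤ w) (hb : β ≤ b) :
    2 * c / ((b + r * w) * b ^ 3 * stretchHyp lam mu (b + r * w) b) ≤ radField lam mu c r w b := by
  have hu : 0 ≤ r * w := mul_nonneg hr hw
  have hb0 : 0 < b := hβ.trans_le hb
  have hW : 0 < stretchHyp lam mu (b + r * w) b :=
    hyp.trans_le (stretchHyp_mono hmu hbulk hβ hb (by linarith))
  have h3 : 0 < lam + 2 * mu := by linarith
  rw [radField]
  have : 0 ≤ w ^ 2 * (3 / (b + r * w) + 4 * b * ((lam + 2 * mu) * (b + r * w) + mu * b)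
        / ((b + r * w) * stretchHyp lam mu (b + r * w) b)) := by positivity
  linarith

lemma radField_pos (hmu : 0 ≤ mu) (hbulk : 0 < 3 * lam + 2 * mu) (hc : 0 < c) (hβ : 0 < β)
    (hyp : 0 < stretchHyp lam mu β β) {r w b : ℝ} (hr : 0 ≤ r) (hw : 0 ≤ w) (hb : β ≤ b) :
    0 < radField lam mu c r w b := by
  have hu : 0 ≤ r * w := mul_nonneg hr hw
  have hb0 : 0 < b := hβ.trans_le hb
  have hW : 0 < stretchHyp lam mu (b + r * w) b :=
    hyp.trans_le (stretchHyp_mono hmu hbulk hβ hb (by linarith))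
  exact lt_of_lt_of_le (by positivity) (radField_lower hmu hbulk hβ hyp hr hw hb)

/-- The quadratic term w²h is at most V·(rw h), and rw h ≤ 3. The constant 3 is sharp enough for two
later uses: V = c/(β⁴ `stretchHyp` β β) reproduces itself, since 2V + 3V = 5V and averaging against
t⁴ divides by 5; and V = w/r cancels the term -3w in a' - b'. -/
lemma radField_upper (hmu : 0 ≤ mu) (hbulk : 0 < 3 * lam + 2 * mu) (hc : 0 < c) (hβ : 0 < β)
    (hyp : 0 < stretchHyp lam mu β β) {r w b V : ℝ} (hr : 0 ≤ r) (hw : 0 ≤ w) (hb : β ≤ b)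
    (hV0 : 0 ≤ V) (hV : w ≤ V * r) :
    radField lam mu c r w b ≤ 2 * c / (β ^ 4 * stretchHyp lam mu β β) + 3 * V := by
  have hu : 0 ≤ r * w := mul_nonneg hr hw
  have hb0 : 0 < b := hβ.trans_le hb
  have hWβ := stretchHyp_mono hmu hbulk hβ hb (by linarith : b ≤ b + r * w)
  have hW : 0 < stretchHyp lam mu (b + r * w) b := hyp.trans_le hWβ
  have hL : 0 < lam + 2 * mu := by linarith
  rw [radField]
  refine add_le_add ?_ ?_
  · have h1 : β ^ 4 ≤ (b + r * w) * b ^ 3 := by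
      calc β ^ 4 = β * β ^ 3 := by ring
        _ ≤ _ := by gcongr; linarith
    gcongr
  · have hkey : r * w * (3 / (b + r * w) + 4 * b * ((lam + 2 * mu) * (b + r * w) + mu * b)
        / ((b + r * w) * stretchHyp lam mu (b + r * w) b)) ≤ 3 := by
      have h2 : 3 - r * w * (3 / (b + r * w) + 4 * b * ((lam + 2 * mu) * (b + r * w) + mu * b)
          / ((b + r * w) * stretchHyp lam mu (b + r * w) b)) =
          b * (3 * stretchHyp lam mu (b + r * w) b
            - 4 * (r * w) * ((lam + 2 * mu) * (b + r * w) + mu * b)) /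
            ((b + r * w) * stretchHyp lam mu (b + r * w) b) := by
        field_simp; ring
      -- Here 3 `stretchHyp` exceeds 9(λ+2μ)(2bu+u²) by the hyperbolicity of (b, b), where u = rw,
      -- and λ+2μ > (4/3)μ or both sides vanish with u.
      have h3 : 0 ≤ 3 * stretchHyp lam mu (b + r * w) b
            - 4 * (r * w) * ((lam + 2 * mu) * (b + r * w) + mu * b) := by
        have h4 : β ^ 2 ≤ b ^ 2 := by gcongr
        rw [stretchHyp] at hyp ⊢
        generalize r * w = u at *
        nlinarith [mul_nonneg hu hb0.le, mul_nonneg hu hu,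
          mul_nonneg hL.le (mul_nonneg hu hu), mul_nonneg hL.le (mul_nonneg hu hb0.le),
          mul_nonneg hmu (mul_nonneg hu hb0.le), mul_nonneg hbulk.le (mul_nonneg hu hb0.le),
          mul_le_mul_of_nonneg_left h4 hbulk.le, mul_le_mul_of_nonneg_left h4 hmu]
      have h5 : 0 ≤ b * (3 * stretchHyp lam mu (b + r * w) b
            - 4 * (r * w) * ((lam + 2 * mu) * (b + r * w) + mu * b)) /
            ((b + r * w) * stretchHyp lam mu (b + r * w) b) := by positivity
      linarith
    have h0 : 0 ≤ 3 / (b + r * w) + 4 * b * ((lam + 2 * mu) * (b + r * w) + mu * b)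
        / ((b + r * w) * stretchHyp lam mu (b + r * w) b) := by positivity
    generalize 3 / (b + r * w) + 4 * b * ((lam + 2 * mu) * (b + r * w) + mu * b)
        / ((b + r * w) * stretchHyp lam mu (b + r * w) b) = h at *
    calc w ^ 2 * h = w * (w * h) := by ring
      _ ≤ V * r * (w * h) := by gcongr
      _ = V * (r * w * h) := by ring
      _ ≤ V * 3 := by gcongr
      _ = 3 * V := by ring

/-- The region in which the fields are considered. -/
def fieldBox (Z Y β : ℝ) : Set (ℝ × (ℝ × ℝ)) := Icc 0 Z ×ˢ (Icc 0 Y ×ˢ Icc β 1)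

lemma exists_lipschitz_of_contDiffOn {f : ℝ × (ℝ × ℝ) → ℝ} {Z Y : ℝ}
    (hf : ContDiffOn ℝ 1 f (fieldBox Z Y β)) :
    ∃ Λ : ℝ, 0 ≤ Λ ∧ ∀ r x y, (r, x) ∈ fieldBox Z Y β → (r, y) ∈ fieldBox Z Y β →
      |f (r, x) - f (r, y)| ≤ Λ * ‖x - y‖ := by
  have hcv : Convex ℝ (fieldBox Z Y β) :=
    (convex_Icc 0 Z).prod ((convex_Icc 0 Y).prod (convex_Icc β 1))
  have hcp : IsCompact (fieldBox Z Y β) := isCompact_Icc.prod (isCompact_Icc.prod isCompact_Icc)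
  obtain ⟨C, hC⟩ := (hf.locallyLipschitzOn hcv).exists_lipschitzOnWith_of_compact hcp
  refine ⟨C, C.2, fun r x y hx hy => ?_⟩
  have := hC.dist_le_mul _ hx _ hy
  rwa [Real.dist_eq, dist_eq_norm, Prod.mk_sub_mk, sub_self, Prod.norm_mk, norm_zero,
    max_eq_right (norm_nonneg _)] at this

lemma contDiffOn_tanField (hβ : 0 < β) (Z Y : ℝ) :
    ContDiffOn ℝ 1 (fun p : ℝ × (ℝ × ℝ) => tanField p.1 p.2.1 p.2.2) (fieldBox Z Y β) := by
  unfold tanField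
  refine ContDiffOn.div (by fun_prop) (by fun_prop) fun p hp => ?_
  have h1 : 0 ≤ p.1 * p.2.1 := mul_nonneg hp.1.1 hp.2.1.1
  have h2 : 0 < p.2.2 := hβ.trans_le hp.2.2.1
  positivity

lemma contDiffOn_radField (hmu : 0 ≤ mu) (hbulk : 0 < 3 * lam + 2 * mu) (hβ : 0 < β)
    (hyp : 0 < stretchHyp lam mu β β) (Z Y : ℝ) :
    ContDiffOn ℝ 1 (fun p : ℝ × (ℝ × ℝ) => radField lam mu c p.1 p.2.1 p.2.2)
      (fieldBox Z Y β) := by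
  have h0 : ∀ p ∈ fieldBox Z Y β, 0 < p.2.2 ∧ 0 < p.2.2 + p.1 * p.2.1 ∧
      0 < stretchHyp lam mu (p.2.2 + p.1 * p.2.1) p.2.2 := fun p hp => by
    have h1 : 0 ≤ p.1 * p.2.1 := mul_nonneg hp.1.1 hp.2.1.1
    have h2 : β ≤ p.2.2 := hp.2.2.1
    exact ⟨by linarith, by linarith,
      hyp.trans_le (stretchHyp_mono hmu hbulk hβ h2 (by linarith))⟩
  have hW : ContDiffOn ℝ 1 (fun p : ℝ × (ℝ × ℝ) =>
      stretchHyp lam mu (p.2.2 + p.1 * p.2.1) p.2.2) (fieldBox Z Y β) := by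
    unfold stretchHyp
    fun_prop
  unfold radField
  refine ContDiffOn.add (ContDiffOn.div (by fun_prop) (by fun_prop) fun p hp => ?_)
    (ContDiffOn.mul (by fun_prop) (ContDiffOn.add
      (ContDiffOn.div (by fun_prop) (by fun_prop) fun p hp => ?_)
      (ContDiffOn.div (by fun_prop) (by fun_prop) fun p hp => ?_)))
  all_goals
    obtain ⟨h1, h2, h3⟩ := h0 p hp
    positivity

end Algebra

/-! ### Existence of profiles up to a finite radius of vanishing radial pressure. -/

section

variable {lam mu c β : ℝ}

lemma abs_clamp_sub_clamp_le (l m x y : ℝ) :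
    |max l (min x m) - max l (min y m)| ≤ |x - y| := by
  have h1 := abs_max_sub_max_le_max l (min x m) l (min y m)
  have h2 := abs_min_sub_min_le_max x m y m
  simp only [sub_self, abs_zero] at h1 h2
  rw [max_eq_right (abs_nonneg (min x m - min y m))] at h1
  rw [max_eq_left (abs_nonneg (x - y))] at h2
  exact h1.trans h2

lemma average_lower {q v : ℝ → ℝ} (hq : Continuous q)
    (hv : ∀ r, v r = ∫ t in (0 : ℝ)..1, t ^ 4 * q (t * r)) {m r : ℝ} (hr : 0 ≤ r)
    (h : ∀ s ∈ Icc 0 r, m ≤ q s) : m / 5 ≤ v r := by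
  have h1 : ∫ t in (0 : ℝ)..1, t ^ 4 * m = m / 5 := by
    rw [intervalIntegral.integral_mul_const, integral_pow]; norm_num; ring
  rw [← h1, hv]
  refine intervalIntegral.integral_mono_on zero_le_one
    ((by fun_prop : Continuous fun t : ℝ => t ^ 4 * m).intervalIntegrable _ _)
    ((by fun_prop : Continuous fun t : ℝ => t ^ 4 * q (t * r)).intervalIntegrable _ _)
    fun t ht => ?_
  exact mul_le_mul_of_nonneg_left
    (h _ ⟨mul_nonneg ht.1 hr, mul_le_of_le_one_left hr ht.2⟩) (by positivity)

lemma average_upper {q v : ℝ → ℝ} (hq : Continuous q)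
    (hv : ∀ r, v r = ∫ t in (0 : ℝ)..1, t ^ 4 * q (t * r)) {m r : ℝ} (hr : 0 ≤ r)
    (h : ∀ s ∈ Icc 0 r, q s ≤ m) : v r ≤ m / 5 := by
  have := average_lower (q := fun s => -q s) (v := fun s => -v s) (m := -m) hq.neg
    (fun s => by simp [hv]) hr fun s hs => neg_le_neg (h s hs)
  linarith

/-- Solutions of the static equations with the tangential stretch cut off above `1`. -/
lemma exists_truncated_profile (hmu : 0 ≤ mu) (hbulk : 0 < 3 * lam + 2 * mu) (hc : 0 < c)
    (hβ : 0 < β) (hβ1 : β < 1) (hyp : 0 < stretchHyp lam mu β β) {Z : ℝ} (hZ : 0 ≤ Z) :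
    ∃ v b q₁ q₂ : ℝ → ℝ, Continuous q₁ ∧ Continuous q₂ ∧
      (∀ r, v r = ∫ t in (0 : ℝ)..1, t ^ 4 * q₁ (t * r)) ∧
      (∀ r, b r = β + ∫ s in (0 : ℝ)..r, q₂ s) ∧
      (∀ r ∈ Icc 0 Z, 0 ≤ v r ∧ β ≤ b r) ∧
      ∀ r ∈ Icc 0 Z, b r ≤ 1 →
        q₁ r = radField lam mu c r (r * v r) (b r) ∧ q₂ r = tanField r (r * v r) (b r) := by
  set V : ℝ := c / (β ^ 4 * stretchHyp lam mu β β) with hVdef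
  have hV : 0 ≤ V := by positivity
  -- The clamp projects onto 0 ≤ r ≤ Z, 0 ≤ w ≤ Vr, β ≤ b ≤ 1. The bounds on v and b found below
  -- show that on [0, Z] only the cut-off b ≤ 1 can be active.
  let κ : ℝ × (ℝ × ℝ) → ℝ × (ℝ × ℝ) := fun p =>
    (max 0 (min p.1 Z), (max 0 (min p.2.1 (V * max 0 (min p.1 Z))), max β (min p.2.2 1)))
  have hκc : Continuous κ := by fun_prop
  have hκ : ∀ p, κ p ∈ fieldBox Z (V * Z) β := fun p => by
    have h1 : max 0 (min p.1 Z) ≤ Z := max_le hZ (min_le_right _ _)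
    have h2 : 0 ≤ max 0 (min p.1 Z) := le_max_left _ _
    refine ⟨⟨h2, h1⟩, ⟨le_max_left _ _, max_le (by positivity) ?_⟩,
      le_max_left _ _, max_le hβ1.le (min_le_right _ _)⟩
    exact (min_le_right _ _).trans (by gcongr)
  have hκL : ∀ r x y, ‖(κ (r, x)).2 - (κ (r, y)).2‖ ≤ ‖x - y‖ := fun r x y => by
    rw [Prod.norm_def, Prod.norm_def]
    exact max_le_max (abs_clamp_sub_clamp_le _ _ _ _) (abs_clamp_sub_clamp_le _ _ _ _)
  let f₁ : ℝ × (ℝ × ℝ) → ℝ := fun p => radField lam mu c p.1 p.2.1 p.2.2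
  let f₂ : ℝ × (ℝ × ℝ) → ℝ := fun p => tanField p.1 p.2.1 p.2.2
  have hf₁ := contDiffOn_radField (c := c) hmu hbulk hβ hyp Z (V * Z)
  have hf₂ := contDiffOn_tanField hβ Z (V * Z)
  obtain ⟨Λ₁, hΛ₁, hL₁⟩ := exists_lipschitz_of_contDiffOn hf₁
  obtain ⟨Λ₂, hΛ₂, hL₂⟩ := exists_lipschitz_of_contDiffOn hf₂
  obtain ⟨v, b, q₁, q₂, hq₁, hq₂, hv, hb, hq⟩ := exists_singular_solution
    (Λ := max Λ₁ Λ₂) hZ (hΛ₁.trans (le_max_left _ _)) β (f₁ ∘ κ) (f₂ ∘ κ)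
    (hf₁.continuousOn.comp_continuous hκc hκ) (hf₂.continuousOn.comp_continuous hκc hκ)
    (fun r x y => (hL₁ _ _ _ (hκ (r, x)) (hκ (r, y))).trans
      (mul_le_mul (le_max_left _ _) (hκL r x y) (norm_nonneg _) (hΛ₁.trans (le_max_left _ _))))
    (fun r x y => (hL₂ _ _ _ (hκ (r, x)) (hκ (r, y))).trans
      (mul_le_mul (le_max_right _ _) (hκL r x y) (norm_nonneg _) (hΛ₁.trans (le_max_left _ _))))
  have hq₁0 : ∀ r ∈ Icc 0 Z, 0 ≤ q₁ r ∧ q₁ r ≤ 5 * V := fun r hr => by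
    rw [(hq r hr).1]
    have h := hκ (r, (r * v r, b r))
    refine ⟨(radField_pos hmu hbulk hc hβ hyp h.1.1 h.2.1.1 h.2.2.1).le,
      (radField_upper hmu hbulk hc hβ hyp h.1.1 h.2.1.1 h.2.2.1 hV ?_).trans_eq ?_⟩
    · exact max_le (mul_nonneg hV h.1.1) (min_le_right _ _)
    · rw [hVdef]; field_simp; ring
  have hq₂0 : ∀ r ∈ Icc 0 Z, 0 ≤ q₂ r := fun r hr => by
    rw [(hq r hr).2]
    have h := hκ (r, (r * v r, b r))
    have h1 := mul_nonneg h.1.1 h.2.1.1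
    have h2 := hβ.le.trans h.2.2.1
    exact div_nonneg (mul_nonneg h.2.1.1 h2) (add_nonneg h2 h1)
  have hv0 : ∀ r ∈ Icc 0 Z, 0 ≤ v r ∧ v r ≤ V := fun r hr => by
    have h1 := average_lower hq₁ hv hr.1 fun s hs => (hq₁0 s ⟨hs.1, hs.2.trans hr.2⟩).1
    have h2 := average_upper hq₁ hv hr.1 fun s hs => (hq₁0 s ⟨hs.1, hs.2.trans hr.2⟩).2
    constructor <;> linarith
  have hb0 : ∀ r ∈ Icc 0 Z, β ≤ b r := fun r hr => by
    rw [hb]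
    have := intervalIntegral.integral_nonneg (μ := MeasureTheory.volume) hr.1
      fun s hs => hq₂0 s ⟨hs.1, hs.2.trans hr.2⟩
    linarith
  refine ⟨v, b, q₁, q₂, hq₁, hq₂, hv, hb, fun r hr => ⟨(hv0 r hr).1, hb0 r hr⟩, fun r hr h1 => ?_⟩
  have e : κ (r, (r * v r, b r)) = (r, (r * v r, b r)) := by
    have hvr := hv0 r hr
    have e1 : max 0 (min r Z) = r := by rw [min_eq_left hr.2, max_eq_right hr.1]
    have e2 : max 0 (min (r * v r) (V * r)) = r * v r := by
      rw [min_eq_left (by nlinarith [hr.1]), max_eq_right (mul_nonneg hr.1 hvr.1)]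
    have e3 : max β (min (b r) 1) = b r := by rw [min_eq_left h1, max_eq_right (hb0 r hr)]
    simp only [κ, e1, e2, e3]
  have := hq r hr
  simp only [Function.comp_apply, e] at this
  exact this

/-- A solution of the static equations up to the radius at which the radial pressure vanishes. -/
structure IsStretchProfile (lam mu c β : ℝ) (a b a' b' : ℝ → ℝ) (R : ℝ) : Prop where
  radius_pos : 0 < R
  hasDerivAt_a : ∀ r, HasDerivAt a (a' r) r
  hasDerivAt_b : ∀ r, HasDerivAt b (b' r) r
  cont_a' : Continuous a'
  cont_b' : Continuous b'
  a_zero : a 0 = β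
  b_zero : b 0 = β
  a'_zero : a' 0 = 0
  b'_zero : b' 0 = 0
  lt_b : ∀ r ∈ Ioc 0 R, β < b r
  b_lt_a : ∀ r ∈ Ioc 0 R, b r < a r
  solves : ∀ r ∈ Ioc 0 R, SolvesStretchSystemAt lam mu c r (a r) (b r) (a' r) (b' r)
  interior : ∀ r ∈ Ico 0 R,
    (lam + 2 * mu) * a r ^ 2 + 2 * lam * b r ^ 2 < 3 * lam + 2 * mu
  boundary : (lam + 2 * mu) * a R ^ 2 + 2 * lam * b R ^ 2 = 3 * lam + 2 * mu

/-- Replacing a² by the smaller b² in the pressure condition leaves (3λ+2μ)b² ≤ 3λ+2μ. Hence the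
cut-off at b = 1 is inactive as long as the radial pressure is nonnegative. -/
lemma tanStretch_le_one_of_pressure (hmu : 0 ≤ mu) (hbulk : 0 < 3 * lam + 2 * mu) {a b : ℝ}
    (hb : 0 ≤ b) (hab : b ≤ a)
    (h : (lam + 2 * mu) * a ^ 2 + 2 * lam * b ^ 2 ≤ 3 * lam + 2 * mu) : b ≤ 1 := by
  have h1 : b ^ 2 ≤ a ^ 2 := by gcongr
  have h3 : 0 < lam + 2 * mu := by linarith
  have : b ^ 2 ≤ 1 := by nlinarith
  nlinarith

lemma radStretch_le_of_pressure (hmu : 0 ≤ mu) (hbulk : 0 < 3 * lam + 2 * mu) {a b : ℝ}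
    (hb : 0 ≤ b) (hab : b ≤ a)
    (h : (lam + 2 * mu) * a ^ 2 + 2 * lam * b ^ 2 ≤ 3 * lam + 2 * mu) :
    a ^ 2 ≤ (3 * lam + 2 * mu + 2 * |lam|) / (lam + 2 * mu) := by
  have h3 : 0 < lam + 2 * mu := by linarith
  have h4 := tanStretch_le_one_of_pressure hmu hbulk hb hab h
  rw [le_div_iff₀ h3]
  have h5 : b ^ 2 ≤ 1 := pow_le_one₀ hb h4
  have h6 := neg_abs_le lam
  nlinarith [abs_nonneg lam, sq_nonneg b]

/-- Nonnegative pressure bounds both stretches, hence the denominator of the gravitational term. The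
resulting m forces the star to end at a finite radius. -/
lemma exists_radField_lower_of_pressure (hmu : 0 ≤ mu) (hbulk : 0 < 3 * lam + 2 * mu)
    (hc : 0 < c) (hβ : 0 < β) (hyp : 0 < stretchHyp lam mu β β) :
    ∃ m : ℝ, 0 < m ∧ ∀ r w b : ℝ, 0 ≤ r → 0 ≤ w → β ≤ b →
      (lam + 2 * mu) * (b + r * w) ^ 2 + 2 * lam * b ^ 2 ≤ 3 * lam + 2 * mu →
      m ≤ radField lam mu c r w b := by
  have hL : 0 < lam + 2 * mu := by linarith
  set A := (3 * lam + 2 * mu + 2 * |lam|) / (lam + 2 * mu) with hA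
  have hA0 : 0 ≤ A := by positivity
  refine ⟨2 * c / ((A + 1) * (3 * (lam + 2 * mu) * A + 2 * |lam| + 1)), by positivity,
    fun r w b hr hw hb h => ?_⟩
  refine le_trans ?_ (radField_lower hmu hbulk hβ hyp hr hw hb)
  have hu : 0 ≤ r * w := mul_nonneg hr hw
  generalize r * w = u at *
  have hb0 : 0 < b := hβ.trans_le hb
  have hW : 0 < stretchHyp lam mu (b + u) b :=
    hyp.trans_le (stretchHyp_mono hmu hbulk hβ hb (by linarith))
  have h1 := tanStretch_le_one_of_pressure hmu hbulk hb0.le (by linarith : b ≤ b + u) h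
  have h2 := radStretch_le_of_pressure hmu hbulk hb0.le (by linarith : b ≤ b + u) h
  rw [← hA] at h2
  have h3 : b + u ≤ A + 1 := by nlinarith [sq_nonneg (b + u - 1)]
  have h5 : b ^ 2 ≤ 1 := pow_le_one₀ hb0.le h1
  have h6 : b ^ 3 ≤ 1 := pow_le_one₀ hb0.le h1
  have h4 : stretchHyp lam mu (b + u) b ≤ 3 * (lam + 2 * mu) * A + 2 * |lam| + 1 := by
    rw [stretchHyp]
    have := le_abs_self lam
    nlinarith [abs_nonneg lam, sq_nonneg b, mul_le_mul_of_nonneg_left h2 hL.le]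
  gcongr
  calc (b + u) * b ^ 3 ≤ (A + 1) * 1 := by gcongr
    _ = A + 1 := mul_one _

/-- Existence of solutions of the static equations for every hyperbolic central state with positive
central pressure. -/
theorem exists_isStretchProfile (hmu : 0 ≤ mu) (hbulk : 0 < 3 * lam + 2 * mu) (hc : 0 < c)
    (hβ : 0 < β) (hβ1 : β < 1) (hyp : 0 < stretchHyp lam mu β β) :
    ∃ (a b a' b' : ℝ → ℝ) (R : ℝ), IsStretchProfile lam mu c β a b a' b' R := by
  have hL : 0 < lam + 2 * mu := by linarith
  obtain ⟨m, hm, hmle⟩ := exists_radField_lower_of_pressure hmu hbulk hc hβ hyp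
  set A := (3 * lam + 2 * mu + 2 * |lam|) / (lam + 2 * mu) with hA
  have hA0 : 0 ≤ A := by positivity
  -- With v ≥ m/5 and Z ≥ 1, this Z gives a(Z) ≥ Z²v > A + 1, whereas positive pressure gives a² ≤ A
  -- and so a ≤ A + 1.
  set Z : ℝ := 5 * (A + 1) / m + 1 with hZdef
  have hZ1 : 1 ≤ Z := by
    rw [hZdef]
    have : 0 ≤ 5 * (A + 1) / m := by positivity
    linarith
  have hZ : 0 ≤ Z := by linarith
  obtain ⟨v, b, q₁, q₂, hq₁, hq₂, hv, hb, hnn, hq⟩ :=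
    exists_truncated_profile hmu hbulk hc hβ hβ1 hyp hZ
  have hdu := hasDerivAt_sq_mul_average hq₁ hv
  have hdb : ∀ r, HasDerivAt b (q₂ r) r := fun r => by
    rw [funext hb]
    exact (intervalIntegral.integral_hasDerivAt_right (hq₂.intervalIntegrable _ _)
      (hq₂.stronglyMeasurableAtFilter _ _) hq₂.continuousAt).const_add β
  have hvc : Continuous v := by
    rw [show v = fun r => ∫ t in (0 : ℝ)..1, t ^ 4 * q₁ (t * r) from funext hv]
    refine intervalIntegral.continuous_parametric_intervalIntegral_of_continuous ?_ continuous_const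
    fun_prop
  have hbc : Continuous b := continuous_iff_continuousAt.2 fun r => (hdb r).continuousAt
  let a : ℝ → ℝ := fun r => b r + r * (r * v r)
  have hac : Continuous a := by fun_prop
  have hda : ∀ r, HasDerivAt a (q₂ r + r * (q₁ r - 3 * v r)) r := fun r => by
    refine ((hdb r).add (hdu r)).congr_of_eventuallyEq (Eventually.of_forall fun s => ?_)
    simp only [a, Pi.add_apply]; ring
  let φ : ℝ → ℝ := fun r => (lam + 2 * mu) * a r ^ 2 + 2 * lam * b r ^ 2
  have hφ : Continuous φ := by fun_prop
  have hb0 : b 0 = β := by rw [hb]; simp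
  have ha0 : a 0 = β := by simp [a, hb0]
  have hab : ∀ r ∈ Icc 0 Z, b r ≤ a r := fun r hr => by
    have h1 := mul_nonneg hr.1 (mul_nonneg hr.1 (hnn r hr).1)
    simp only [a]; linarith
  have hle1 : ∀ r ∈ Icc 0 Z, φ r ≤ 3 * lam + 2 * mu → b r ≤ 1 := fun r hr h =>
    tanStretch_le_one_of_pressure hmu hbulk (hβ.le.trans (hnn r hr).2) (hab r hr) h
  have hvlow : ∀ r ∈ Icc 0 Z, (∀ s ∈ Icc 0 r, φ s ≤ 3 * lam + 2 * mu) → m / 5 ≤ v r :=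
    fun r hr h => average_lower hq₁ hv hr.1 fun s hs => by
      have hs' : s ∈ Icc 0 Z := ⟨hs.1, hs.2.trans hr.2⟩
      rw [(hq s hs' (hle1 s hs' (h s hs))).1]
      exact hmle _ _ _ hs.1 (mul_nonneg hs.1 (hnn s hs').1) (hnn s hs').2 (h s hs)
  have hex : ∃ r ∈ Icc 0 Z, 3 * lam + 2 * mu ≤ φ r := by
    by_contra! hcon
    have hZm : Z ∈ Icc 0 Z := ⟨hZ, le_rfl⟩
    have h1 := hvlow Z hZm fun s hs => (hcon s hs).le
    have h2 := radStretch_le_of_pressure hmu hbulk (hβ.le.trans (hnn Z hZm).2) (hab Z hZm)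
      (hcon Z hZm).le
    rw [← hA] at h2
    have h3 : a Z ≤ A + 1 := by nlinarith [sq_nonneg (a Z - 1)]
    have h4 : Z * (m / 5) ≤ Z * (Z * v Z) := by
      have : m / 5 ≤ Z * v Z := by nlinarith
      gcongr
    have h5 : A + 1 < Z * (m / 5) := by
      rw [hZdef]
      have : 5 * (A + 1) / m * (m / 5) = A + 1 := by field_simp
      nlinarith
    have h6 : a Z = b Z + Z * (Z * v Z) := rfl
    have h7 := (hnn Z hZm).2
    linarith
  -- The radius is the first point where the radial pressure fails to be positive; compactness
  -- provides a least one.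
  have hScl : IsCompact {r ∈ Icc 0 Z | 3 * lam + 2 * mu ≤ φ r} :=
    isCompact_Icc.inter_right (isClosed_le continuous_const hφ)
  obtain ⟨R, hRm, hRleast⟩ := hScl.exists_isLeast (by obtain ⟨r, hr, h⟩ := hex; exact ⟨r, hr, h⟩)
  have hint : ∀ r ∈ Ico 0 R, φ r < 3 * lam + 2 * mu := fun r hr => by
    by_contra! h
    exact absurd (hRleast ⟨⟨hr.1, hr.2.le.trans hRm.1.2⟩, h⟩) (not_le.2 hr.2)
  have hR0 : 0 < R := by
    rcases hRm.1.1.eq_or_lt with h | h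
    · exfalso
      have h1 := hRm.2
      rw [← h] at h1
      simp only [φ, ha0, hb0] at h1
      have h2 : β ^ 2 < 1 := pow_lt_one₀ hβ.le hβ1 (by norm_num)
      nlinarith [mul_pos hbulk (sub_pos.2 h2)]
    · exact h
  have hbd : φ R = 3 * lam + 2 * mu := by
    refine le_antisymm ?_ hRm.2
    have h1 : Tendsto φ (𝓝[<] R) (𝓝 (φ R)) := (hφ.tendsto R).mono_left nhdsWithin_le_nhds
    refine le_of_tendsto h1 ?_
    filter_upwards [Ioo_mem_nhdsLT hR0] with s hs
    exact (hint s ⟨hs.1.le, hs.2⟩).le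
  have hφle : ∀ r ∈ Icc 0 R, φ r ≤ 3 * lam + 2 * mu := fun r hr => by
    rcases hr.2.eq_or_lt with h | h
    · rw [h, hbd]
    · exact (hint r ⟨hr.1, h⟩).le
  have hsub : ∀ r ∈ Icc 0 R, r ∈ Icc 0 Z := fun r hr => ⟨hr.1, hr.2.trans hRm.1.2⟩
  have hvpos : ∀ r ∈ Icc 0 R, 0 < v r := fun r hr => by
    have := hvlow r (hsub r hr) fun s hs => hφle s ⟨hs.1, hs.2.trans hr.2⟩
    linarith
  have hqR : ∀ r ∈ Icc 0 R, q₁ r = radField lam mu c r (r * v r) (b r) ∧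
      q₂ r = tanField r (r * v r) (b r) := fun r hr =>
    hq r (hsub r hr) (hle1 r (hsub r hr) (hφle r hr))
  have hmono : StrictMonoOn b (Icc 0 R) := by
    refine strictMonoOn_of_deriv_pos (convex_Icc 0 R) hbc.continuousOn fun r hr => ?_
    rw [interior_Icc] at hr
    have hr' : r ∈ Icc 0 R := ⟨hr.1.le, hr.2.le⟩
    rw [(hdb r).deriv, (hqR r hr').2, tanField]
    have h1 := hvpos r hr'
    have h2 := hβ.trans_le (hnn r (hsub r hr')).2
    have h3 := hr.1
    positivity
  have hba : ∀ r ∈ Ioc 0 R, b r < a r := fun r hr => by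
    have h1 := hvpos r ⟨hr.1.le, hr.2⟩
    have h3 := hr.1
    have : 0 < r * (r * v r) := by positivity
    simp only [a]; linarith
  refine ⟨a, b, _, q₂, R, hR0, hda, hdb, by fun_prop, hq₂, ha0, hb0, ?_, ?_, fun r hr => ?_, hba,
    fun r hr => ?_, hint, hbd⟩
  · rw [(hqR 0 ⟨le_rfl, hR0.le⟩).2]; simp [tanField]
  · rw [(hqR 0 ⟨le_rfl, hR0.le⟩).2]; simp [tanField]
  · have := hmono ⟨le_rfl, hR0.le⟩ ⟨hr.1.le, hr.2⟩ hr.1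
    rwa [hb0] at this
  · have hr' : r ∈ Icc 0 R := ⟨hr.1.le, hr.2⟩
    have h2 := (hnn r (hsub r hr')).2
    have hb' : 0 < b r := hβ.trans_le h2
    have ha' : 0 < a r := hb'.trans (hba r hr)
    have hW := hyp.trans_le (stretchHyp_mono hmu hbulk hβ h2 (hba r hr).le)
    have e : (a r - b r) / r = r * v r := by
      have := hr.1.ne'
      simp only [a]; field_simp; ring
    rw [solvesStretchSystemAt_iff hr.1.ne' ha'.ne' hb'.ne' hW.ne', e]
    refine ⟨(hqR r hr').2, ?_⟩
    rw [← (hqR r hr').1]; ring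

end

/-! ### Uniqueness of profiles from the central state. -/

section

/-- Grönwall's argument from an endpoint at which only a limit is known: exp(-kr) f is antitone and
tends to 0 there. -/
lemma nonpos_of_deriv_le_mul {f f' : ℝ → ℝ} {R k : ℝ}
    (hf : ∀ r ∈ Ioo 0 R, HasDerivAt f (f' r) r) (hf' : ∀ r ∈ Ioo 0 R, f' r ≤ k * f r)
    (h0 : Tendsto f (𝓝[>] 0) (𝓝 0)) : ∀ r ∈ Ioo 0 R, f r ≤ 0 := by
  intro r hr
  have hd : ∀ s ∈ Ioo 0 R, HasDerivAt (fun s => Real.exp (-k * s) * f s)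
      (Real.exp (-k * s) * (f' s - k * f s)) s := fun s hs => by
    have h1 : HasDerivAt (fun s => Real.exp (-k * s)) (Real.exp (-k * s) * (-k)) s := by
      simpa using ((hasDerivAt_id s).const_mul (-k)).exp
    refine (h1.mul (hf s hs)).congr_deriv ?_
    ring
  have hanti : AntitoneOn (fun s => Real.exp (-k * s) * f s) (Ioo 0 R) := by
    refine antitoneOn_of_deriv_nonpos (convex_Ioo 0 R)
      (fun s hs => (hd s hs).continuousAt.continuousWithinAt) ?_ ?_
    · rw [interior_Ioo]
      exact fun s hs => (hd s hs).differentiableAt.differentiableWithinAt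
    · rw [interior_Ioo]
      intro s hs
      rw [(hd s hs).deriv]
      exact mul_nonpos_of_nonneg_of_nonpos (Real.exp_pos _).le (by linarith [hf' s hs])
  have hlim : Tendsto (fun s => Real.exp (-k * s) * f s) (𝓝[>] 0) (𝓝 0) := by
    have h1 : Tendsto (fun s => Real.exp (-k * s)) (𝓝[>] 0) (𝓝 (Real.exp (-k * 0))) :=
      ((by fun_prop : Continuous fun s => Real.exp (-k * s)).tendsto 0).mono_left
        nhdsWithin_le_nhds
    simpa using h1.mul h0
  have h2 : Real.exp (-k * r) * f r ≤ 0 := by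
    refine ge_of_tendsto hlim ?_
    filter_upwards [Ioo_mem_nhdsGT hr.1] with s hs
    exact hanti ⟨hs.1, hs.2.trans hr.2⟩ hr hs.2.le
  by_contra! h3
  exact absurd h2 (not_le.2 (mul_pos (Real.exp_pos _) h3))

lemma not_isMinOn_of_deriv_pos {f : ℝ → ℝ} {f' r s : ℝ} (hf : HasDerivAt f f' r) (hf' : 0 < f')
    (hs : s < r) : ∃ t ∈ Ioo s r, f t < f r := by
  have h1 : Tendsto (slope f r) (𝓝[<] r) (𝓝 f') :=
    (hasDerivAt_iff_tendsto_slope.1 hf).mono_left (nhdsWithin_mono _ fun x hx => ne_of_lt hx)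
  obtain ⟨t, ht1, ht2⟩ := ((h1.eventually (lt_mem_nhds hf')).and (Ioo_mem_nhdsLT hs)).exists
  refine ⟨t, ht2, ?_⟩
  rw [slope_def_field] at ht1
  have h3 : t - r < 0 := by linarith [ht2.2]
  have := (div_pos_iff.1 ht1).resolve_left (fun h => absurd h.2 (not_lt.2 h3.le))
  linarith [this.1]

/-- A negative value would yield a negative minimum on some [s, r] away from its left end; a
positive derivative there gives smaller values just to the left. The same argument excludes zeros.
-/
lemma pos_of_deriv_pos {f f' : ℝ → ℝ} {R : ℝ}
    (hf : ∀ r ∈ Ioo 0 R, HasDerivAt f (f' r) r) (hf' : ∀ r ∈ Ioo 0 R, f r ≤ 0 → 0 < f' r)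
    (h0 : Tendsto f (𝓝[>] 0) (𝓝 0)) : ∀ r ∈ Ioo 0 R, 0 < f r := by
  have hnn : ∀ r ∈ Ioo 0 R, 0 ≤ f r := by
    intro r hr
    by_contra! hneg
    obtain ⟨s, hs1, hs2⟩ := ((h0.eventually (lt_mem_nhds hneg)).and
      (Ioo_mem_nhdsGT hr.1)).exists
    have hc : ContinuousOn f (Icc s r) := fun t ht =>
      (hf t ⟨hs2.1.trans_le ht.1, ht.2.trans_lt hr.2⟩).continuousAt.continuousWithinAt
    obtain ⟨t, ht, hmin⟩ := isCompact_Icc.exists_isMinOn ⟨s, left_mem_Icc.2 hs2.2.le⟩ hc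
    have htr : f t ≤ f r := hmin (right_mem_Icc.2 hs2.2.le)
    have hts : s < t := by
      rcases ht.1.eq_or_lt with h | h
      · rw [← h] at htr; exact absurd htr (not_le.2 hs1)
      · exact h
    have ht' : t ∈ Ioo 0 R := ⟨hs2.1.trans hts, ht.2.trans_lt hr.2⟩
    obtain ⟨x, hx, hlt⟩ := not_isMinOn_of_deriv_pos (hf t ht') (hf' t ht' (by linarith)) hts
    exact absurd (hmin ⟨hx.1.le, hx.2.le.trans ht.2⟩ : f t ≤ f x) (not_le.2 hlt)
  intro r hr
  refine (hnn r hr).lt_of_ne fun h => ?_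
  obtain ⟨x, hx, hlt⟩ := not_isMinOn_of_deriv_pos (hf r hr) (hf' r hr h.symm.le) hr.1
  exact absurd (hnn x ⟨hx.1, hx.2.trans hr.2⟩) (not_le.2 (hlt.trans_eq h.symm))

variable {lam mu c β : ℝ}

/-- A solution of the static equations on `(0, R)` with isotropic central stretch `β`. -/
structure IsInnerProfile (lam mu c β : ℝ) (a b a' b' : ℝ → ℝ) (R : ℝ) : Prop where
  hasDerivAt_a : ∀ r ∈ Ioo 0 R, HasDerivAt a (a' r) r
  hasDerivAt_b : ∀ r ∈ Ioo 0 R, HasDerivAt b (b' r) r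
  a_pos : ∀ r ∈ Ioo 0 R, 0 < a r
  b_pos : ∀ r ∈ Ioo 0 R, 0 < b r
  solves : ∀ r ∈ Ioo 0 R, SolvesStretchSystemAt lam mu c r (a r) (b r) (a' r) (b' r)
  tendsto_a : Tendsto a (𝓝[>] 0) (𝓝 β)
  tendsto_b : Tendsto b (𝓝[>] 0) (𝓝 β)
  pressure : ∀ r ∈ Ioo 0 R,
    (lam + 2 * mu) * a r ^ 2 + 2 * lam * b r ^ 2 < 3 * lam + 2 * mu

lemma IsInnerProfile.mono {a b a' b' : ℝ → ℝ} {R R' : ℝ}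
    (h : IsInnerProfile lam mu c β a b a' b' R) (hR : R' ≤ R) :
    IsInnerProfile lam mu c β a b a' b' R' := by
  have hs : Ioo 0 R' ⊆ Ioo 0 R := Ioo_subset_Ioo_right hR
  exact ⟨fun r hr => h.1 r (hs hr), fun r hr => h.2 r (hs hr), fun r hr => h.3 r (hs hr),
    fun r hr => h.4 r (hs hr), fun r hr => h.5 r (hs hr), h.6, h.7, fun r hr => h.8 r (hs hr)⟩

lemma IsInnerProfile.lt_b {a b a' b' : ℝ → ℝ} {R : ℝ}
    (h : IsInnerProfile lam mu c β a b a' b' R) (hab : ∀ r ∈ Ioo 0 R, b r < a r) :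
    ∀ r ∈ Ioo 0 R, β < b r := by
  have hmono : StrictMonoOn b (Ioo 0 R) := by
    refine strictMonoOn_of_deriv_pos (convex_Ioo 0 R)
      (fun s hs => (h.hasDerivAt_b s hs).continuousAt.continuousWithinAt) ?_
    rw [interior_Ioo]
    intro r hr
    rw [(h.hasDerivAt_b r hr).deriv]
    have h1 := (h.solves r hr).tan_eq
    have h2 : 0 < r * b' r := by
      rw [h1]
      exact div_pos (mul_pos (h.b_pos r hr) (sub_pos.2 (hab r hr))) (h.a_pos r hr)
    exact (mul_pos_iff_of_pos_left hr.1).1 h2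
  intro r hr
  have hr2 : r / 2 ∈ Ioo 0 R := ⟨by linarith [hr.1], by linarith [hr.1, hr.2]⟩
  have h1 : β ≤ b (r / 2) := by
    refine le_of_tendsto h.tendsto_b ?_
    filter_upwards [Ioo_mem_nhdsGT hr2.1] with s hs
    exact (hmono ⟨hs.1, hs.2.trans hr2.2⟩ hr2 hs.2).le
  exact h1.trans_lt (hmono hr2 hr (by linarith [hr.1]))

/-- Near the center, wherever a ≤ b, gravity and the anisotropy term both push a upwards while b
does not increase, so a > b there. Further out, at a first contact a = b, the anisotropy term
vanishes and gravity makes a - b increasing, although a - b was positive before. -/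
lemma IsInnerProfile.b_lt_a {a b a' b' : ℝ → ℝ} {R : ℝ} (hmu : 0 ≤ mu)
    (hbulk : 0 < 3 * lam + 2 * mu) (hc : 0 < c) (hβ : 0 < β) (hyp : 0 < stretchHyp lam mu β β)
    (h : IsInnerProfile lam mu c β a b a' b' R) : ∀ r ∈ Ioo 0 R, b r < a r := by
  have hd : ∀ r ∈ Ioo 0 R, HasDerivAt (fun s => a s - b s) (a' r - b' r) r := fun r hr =>
    (h.hasDerivAt_a r hr).sub (h.hasDerivAt_b r hr)
  have hlim : Tendsto (fun s => a s - b s) (𝓝[>] 0) (𝓝 0) := by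
    simpa using h.tendsto_a.sub h.tendsto_b
  have hstep : ∀ r ∈ Ioo 0 R, a r - b r ≤ 0 → 0 < stretchHyp lam mu (a r) (b r) →
      (a r - b r) * ((3 * lam + 2 * mu) - (lam + 2 * mu) * a r ^ 2
        - 2 * (lam + mu) * (a r * b r + b r ^ 2)) ≥ 0 → 0 < a' r - b' r := by
    intro r hr hle hW hG
    have ha := h.a_pos r hr
    have hb := h.b_pos r hr
    have hr0 := hr.1
    have h1 := (h.solves r hr).tan_eq
    have h2 := (h.solves r hr).rad_eq
    have hb' : r * b' r ≤ 0 := by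
      rw [h1]
      exact div_nonpos_of_nonpos_of_nonneg (mul_nonpos_of_nonneg_of_nonpos hb.le hle) ha.le
    have ha' : 0 < r * a' r * stretchHyp lam mu (a r) (b r) := by
      rw [h2, mul_assoc (2 * b r)]
      have : 0 < 2 * c * r ^ 2 / (a r * b r ^ 3) := by positivity
      have : 0 ≤ 2 * b r * ((a r - b r) * ((3 * lam + 2 * mu) - (lam + 2 * mu) * a r ^ 2
        - 2 * (lam + mu) * (a r * b r + b r ^ 2))) / a r := by positivity
      linarith
    have ha'' := (mul_pos_iff_of_pos_right hW).1 ha'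
    have : 0 < r * (a' r - b' r) := by linarith
    exact (mul_pos_iff_of_pos_left hr0).1 this
  obtain ⟨ε, hε, hnear⟩ : ∃ ε > 0, ∀ r ∈ Ioo 0 (min ε R), 0 < a r - b r := by
    have hWlim : Tendsto (fun r => stretchHyp lam mu (a r) (b r)) (𝓝[>] 0)
        (𝓝 (stretchHyp lam mu β β)) :=
      (((h.tendsto_a.pow 2).const_mul _).add ((h.tendsto_b.pow 2).const_mul _)).sub_const _
    have hGlim : Tendsto (fun r => (3 * lam + 2 * mu) - (lam + 2 * mu) * a r ^ 2
        - 2 * (lam + mu) * (a r * b r + b r ^ 2)) (𝓝[>] 0)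
        (𝓝 ((3 * lam + 2 * mu) - (lam + 2 * mu) * β ^ 2 - 2 * (lam + mu) * (β * β + β ^ 2))) :=
      (((h.tendsto_a.pow 2).const_mul _).const_sub _).sub
        (((h.tendsto_a.mul h.tendsto_b).add (h.tendsto_b.pow 2)).const_mul _)
    -- At the center this factor equals -`stretchHyp` β β.
    have hG0 : (3 * lam + 2 * mu) - (lam + 2 * mu) * β ^ 2 - 2 * (lam + mu) * (β * β + β ^ 2)
        < 0 := by
      rw [stretchHyp] at hyp; linarith
    have hev := (hWlim.eventually (lt_mem_nhds hyp)).and (hGlim.eventually (gt_mem_nhds hG0))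
    obtain ⟨ε, hε, hsub⟩ := (mem_nhdsGT_iff_exists_Ioo_subset).1 hev
    refine ⟨ε, hε, pos_of_deriv_pos (f' := fun r => a' r - b' r)
      (fun r hr => hd r ⟨hr.1, hr.2.trans_le (min_le_right _ _)⟩) (fun r hr hle => ?_) hlim⟩
    have hm := hsub ⟨hr.1, hr.2.trans_le (min_le_left _ _)⟩
    exact hstep r ⟨hr.1, hr.2.trans_le (min_le_right _ _)⟩ hle hm.1
      (mul_nonneg_of_nonpos_of_nonpos hle hm.2.le)
  intro r₁ hr₁
  by_contra! hcon
  -- The left end stays away from the center, so the contact set is compact, and it lies below ε,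
  -- where a > b is already known.
  have hcont : ContinuousOn (fun s => a s - b s) (Icc (min (ε / 2) r₁) r₁) := fun s hs => by
    have h1 : 0 < min (ε / 2) r₁ := lt_min (half_pos hε) hr₁.1
    exact (hd s ⟨h1.trans_le hs.1, hs.2.trans_lt hr₁.2⟩).continuousAt.continuousWithinAt
  have hcp : IsCompact (Icc (min (ε / 2) r₁) r₁ ∩ (fun s => a s - b s) ⁻¹' Iic 0) :=
    isCompact_Icc.of_isClosed_subset
      (hcont.preimage_isClosed_of_isClosed isClosed_Icc isClosed_Iic) inter_subset_left
  obtain ⟨r₀, hr₀, hleast⟩ := hcp.exists_isLeast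
    ⟨r₁, ⟨min_le_right _ _, le_rfl⟩, by simpa using hcon⟩
  have hpos₀ : 0 < r₀ := (lt_min (half_pos hε) hr₁.1).trans_le hr₀.1.1
  have hr₀R : r₀ < R := hr₀.1.2.trans_lt hr₁.2
  have hbelow : ∀ r ∈ Ioo 0 r₀, 0 < a r - b r := fun r hr => by
    rcases lt_or_ge r (min (ε / 2) r₁) with hlt | hge
    · refine hnear r ⟨hr.1, lt_min (hlt.trans_le (min_le_left _ _) |>.trans (half_lt_self hε)) ?_⟩
      exact hr.2.trans hr₀R
    · by_contra! hle
      exact absurd (hleast ⟨⟨hge, hr.2.le.trans hr₀.1.2⟩, hle⟩) (not_le.2 hr.2)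
  have hmem : r₀ ∈ Ioo 0 R := ⟨hpos₀, hr₀R⟩
  have hle : a r₀ - b r₀ ≤ 0 := hr₀.2
  have hzero : a r₀ - b r₀ = 0 := by
    refine le_antisymm hle (ge_of_tendsto
      ((hd r₀ hmem).continuousAt.tendsto.mono_left nhdsWithin_le_nhds : Tendsto _ (𝓝[<] r₀) _) ?_)
    filter_upwards [Ioo_mem_nhdsLT hpos₀] with s hs
    exact (hbelow s hs).le
  have hblow : β ≤ b r₀ := by
    refine ge_of_tendsto ((h.hasDerivAt_b r₀ hmem).continuousAt.tendsto.mono_left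
      nhdsWithin_le_nhds : Tendsto _ (𝓝[<] r₀) _) ?_
    filter_upwards [Ioo_mem_nhdsLT hpos₀] with s hs
    exact ((h.mono hr₀R.le).lt_b (fun r hr => sub_pos.1 (hbelow r hr)) s hs).le
  have hW := hyp.trans_le (stretchHyp_mono hmu hbulk hβ hblow (sub_eq_zero.1 hzero).ge)
  have hd0 := hstep r₀ hmem hle hW (by rw [hzero, zero_mul])
  obtain ⟨t, ht, hlt⟩ := not_isMinOn_of_deriv_pos (hd r₀ hmem) hd0 hpos₀
  linarith [hbelow t ht]

/-- Taking V = w/r in `radField_upper` gives a' - b' ≤ 2Cr, which integrates from the center. It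
yields w → 0, which continuity of the stretches alone does not give. -/
lemma IsInnerProfile.sub_div_le {a b a' b' : ℝ → ℝ} {R : ℝ} (hmu : 0 ≤ mu)
    (hbulk : 0 < 3 * lam + 2 * mu) (hc : 0 < c) (hβ : 0 < β) (hyp : 0 < stretchHyp lam mu β β)
    (h : IsInnerProfile lam mu c β a b a' b' R) :
    ∀ r ∈ Ioo 0 R, (a r - b r) / r ≤ c / (β ^ 4 * stretchHyp lam mu β β) * r := by
  have hba := h.b_lt_a hmu hbulk hc hβ hyp
  have hβb := h.lt_b hba
  set C := c / (β ^ 4 * stretchHyp lam mu β β) with hC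
  have key := nonpos_of_deriv_le_mul (f := fun r => a r - b r - C * r ^ 2)
    (f' := fun r => a' r - b' r - C * (2 * r)) (R := R) (k := 0)
    (fun r hr => by
      have := ((h.hasDerivAt_a r hr).sub (h.hasDerivAt_b r hr)).sub
        ((hasDerivAt_pow 2 r).const_mul C)
      exact this.congr_deriv (by simp))
    (fun r hr => by
      have ha := h.a_pos r hr
      have hb := h.b_pos r hr
      have hr0 := hr.1
      have hW := hyp.trans_le (stretchHyp_mono hmu hbulk hβ (hβb r hr).le (hba r hr).le)
      have h1 := ((solvesStretchSystemAt_iff hr.1.ne' ha.ne' hb.ne' hW.ne').1 (h.solves r hr)).2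
      have hy : 0 ≤ (a r - b r) / r := div_nonneg (sub_nonneg.2 (hba r hr).le) hr0.le
      have h2 := radField_upper hmu hbulk hc hβ hyp hr0.le hy (hβb r hr).le
        (V := (a r - b r) / r / r) (by positivity) (by field_simp; rfl)
      have h3 : r * radField lam mu c r ((a r - b r) / r) (b r) ≤
          r * (2 * c / (β ^ 4 * stretchHyp lam mu β β) + 3 * ((a r - b r) / r / r)) := by gcongr
      have h4 : r * (2 * c / (β ^ 4 * stretchHyp lam mu β β) + 3 * ((a r - b r) / r / r)) =
          C * (2 * r) + 3 * ((a r - b r) / r) := by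
        rw [hC]; field_simp
      linarith)
    (by
      have h1 : Tendsto (fun r : ℝ => C * r ^ 2) (𝓝[>] 0) (𝓝 (C * 0 ^ 2)) :=
        ((by fun_prop : Continuous fun r : ℝ => C * r ^ 2).tendsto 0).mono_left nhdsWithin_le_nhds
      simpa using (h.tendsto_a.sub h.tendsto_b).sub h1)
  intro r hr
  rw [div_le_iff₀ hr.1]
  have := key r hr
  linarith

/-- Solutions of the static equations are determined by their central stretch. -/
theorem IsInnerProfile.unique {a₁ b₁ a₁' b₁' a₂ b₂ a₂' b₂' : ℝ → ℝ} {R : ℝ} (hmu : 0 ≤ mu)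
    (hbulk : 0 < 3 * lam + 2 * mu) (hc : 0 < c) (hβ : 0 < β) (hyp : 0 < stretchHyp lam mu β β)
    (h₁ : IsInnerProfile lam mu c β a₁ b₁ a₁' b₁' R)
    (h₂ : IsInnerProfile lam mu c β a₂ b₂ a₂' b₂' R) :
    ∀ r ∈ Ioo 0 R, a₁ r = a₂ r ∧ b₁ r = b₂ r := by
  rcases le_or_gt R 0 with hR | hR
  · intro r hr; exact absurd (hr.1.trans hr.2) (not_lt.2 hR)
  set C := c / (β ^ 4 * stretchHyp lam mu β β) with hC
  have hC0 : 0 ≤ C := by positivity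
  obtain ⟨Λ₁, hΛ₁, hL₁⟩ := exists_lipschitz_of_contDiffOn
    (contDiffOn_radField (c := c) hmu hbulk hβ hyp R (C * R))
  obtain ⟨Λ₂, hΛ₂, hL₂⟩ := exists_lipschitz_of_contDiffOn (contDiffOn_tanField hβ R (C * R))
  have main : ∀ (a b a' b' : ℝ → ℝ), IsInnerProfile lam mu c β a b a' b' R →
      (∀ r ∈ Ioo 0 R, (r, ((a r - b r) / r, b r)) ∈ fieldBox R (C * R) β) ∧
      (∀ r ∈ Ioo 0 R, HasDerivAt (fun s => (a s - b s) / s)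
        (radField lam mu c r ((a r - b r) / r) (b r) - 4 * ((a r - b r) / r) / r) r) ∧
      (∀ r ∈ Ioo 0 R, HasDerivAt b (tanField r ((a r - b r) / r) (b r)) r) ∧
      Tendsto (fun s => (a s - b s) / s) (𝓝[>] 0) (𝓝 0) := by
    intro a b a' b' h
    have hba := h.b_lt_a hmu hbulk hc hβ hyp
    have hβb := h.lt_b hba
    have hle := h.sub_div_le hmu hbulk hc hβ hyp
    have hiff : ∀ r ∈ Ioo 0 R, _ := fun r hr =>
      (solvesStretchSystemAt_iff hr.1.ne' (h.a_pos r hr).ne' (h.b_pos r hr).ne'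
        (hyp.trans_le (stretchHyp_mono hmu hbulk hβ (hβb r hr).le (hba r hr).le)).ne').1
        (h.solves r hr)
    refine ⟨fun r hr => ?_, fun r hr => ?_, fun r hr => ?_, ?_⟩
    · refine ⟨⟨hr.1.le, hr.2.le⟩, ⟨div_nonneg (sub_nonneg.2 (hba r hr).le) hr.1.le, ?_⟩,
        (hβb r hr).le, tanStretch_le_one_of_pressure hmu hbulk (h.b_pos r hr).le (hba r hr).le
          (h.pressure r hr).le⟩
      exact (hle r hr).trans (mul_le_mul_of_nonneg_left hr.2.le hC0)
    · have h1 := ((h.hasDerivAt_a r hr).sub (h.hasDerivAt_b r hr)).div (hasDerivAt_id r) hr.1.ne'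
      refine h1.congr_deriv ?_
      have h2 := (hiff r hr).2
      have hr0 := hr.1.ne'
      rw [h2]
      simp only [id, Pi.sub_apply]
      field_simp
      ring
    · rw [← (hiff r hr).1]
      exact h.hasDerivAt_b r hr
    · have h1 : Tendsto (fun r : ℝ => C * r) (𝓝[>] 0) (𝓝 0) := by
        have : Tendsto (fun r : ℝ => C * r) (𝓝 0) (𝓝 (C * 0)) :=
          (by fun_prop : Continuous fun r : ℝ => C * r).tendsto 0
        rw [mul_zero] at this
        exact this.mono_left nhdsWithin_le_nhds
      refine squeeze_zero' ?_ ?_ h1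
      · filter_upwards [Ioo_mem_nhdsGT hR] with r hr
        exact div_nonneg (sub_nonneg.2 (hba r hr).le) hr.1.le
      · filter_upwards [Ioo_mem_nhdsGT hR] with r hr
        exact hle r hr
  obtain ⟨hm₁, hy₁, hd₁, hl₁⟩ := main _ _ _ _ h₁
  obtain ⟨hm₂, hy₂, hd₂, hl₂⟩ := main _ _ _ _ h₂
  set y₁ : ℝ → ℝ := fun s => (a₁ s - b₁ s) / s with hy₁def
  set y₂ : ℝ → ℝ := fun s => (a₂ s - b₂ s) / s with hy₂def
  have key := nonpos_of_deriv_le_mul (R := R) (k := 2 * (Λ₁ + Λ₂))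
    (f := fun r => (y₁ r - y₂ r) ^ 2 + (b₁ r - b₂ r) ^ 2)
    (fun r hr => (((hy₁ r hr).sub (hy₂ r hr)).pow 2).add (((hd₁ r hr).sub (hd₂ r hr)).pow 2))
    (fun r hr => by
      have e₁ := hL₁ r _ _ (hm₁ r hr) (hm₂ r hr)
      have e₂ := hL₂ r _ _ (hm₁ r hr) (hm₂ r hr)
      rw [Prod.norm_def] at e₁ e₂
      simp only [Prod.fst_sub, Prod.snd_sub, Real.norm_eq_abs] at e₁ e₂
      change |_ - _| ≤ Λ₁ * max |y₁ r - y₂ r| |b₁ r - b₂ r| at e₁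
      change |_ - _| ≤ Λ₂ * max |y₁ r - y₂ r| |b₁ r - b₂ r| at e₂
      simp only [Pi.sub_apply]
      change (_ : ℝ) * (y₁ r - y₂ r) ^ (2 - 1) * (radField lam mu c r (y₁ r) (b₁ r)
        - 4 * y₁ r / r - (radField lam mu c r (y₂ r) (b₂ r) - 4 * y₂ r / r)) +
        _ * (b₁ r - b₂ r) ^ (2 - 1) * (tanField r (y₁ r) (b₁ r) - tanField r (y₂ r) (b₂ r)) ≤ _
      change |radField lam mu c r (y₁ r) (b₁ r) - radField lam mu c r (y₂ r) (b₂ r)| ≤ _ at e₁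
      change |tanField r (y₁ r) (b₁ r) - tanField r (y₂ r) (b₂ r)| ≤ _ at e₂
      set D := y₁ r - y₂ r with hD
      set E := b₁ r - b₂ r with hE
      set F := radField lam mu c r (y₁ r) (b₁ r) - radField lam mu c r (y₂ r) (b₂ r) with hF
      set G := tanField r (y₁ r) (b₁ r) - tanField r (y₂ r) (b₂ r) with hG
      set M := max |D| |E| with hM
      have hM0 : 0 ≤ M := (abs_nonneg D).trans (le_max_left _ _)
      have i1 : D * F ≤ M * (Λ₁ * M) := by
        refine (le_abs_self _).trans ?_
        rw [abs_mul]
        exact mul_le_mul (le_max_left _ _) e₁ (abs_nonneg _) hM0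
      have i2 : E * G ≤ M * (Λ₂ * M) := by
        refine (le_abs_self _).trans ?_
        rw [abs_mul]
        exact mul_le_mul (le_max_right _ _) e₂ (abs_nonneg _) hM0
      have i3 : M ^ 2 ≤ D ^ 2 + E ^ 2 := by
        rcases max_choice |D| |E| with hh | hh <;> rw [hM, hh, sq_abs] <;>
          nlinarith [sq_nonneg D, sq_nonneg E]
      -- The singular term enters the derivative of the squared distance with a negative sign, so it
      -- can be dropped.
      have i4 : 0 ≤ D ^ 2 * (4 / r) := mul_nonneg (sq_nonneg _) (div_nonneg (by norm_num) hr.1.le)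
      have e3 : radField lam mu c r (y₁ r) (b₁ r) - 4 * y₁ r / r
          - (radField lam mu c r (y₂ r) (b₂ r) - 4 * y₂ r / r) = F - D * (4 / r) := by
        rw [hF, hD]; ring
      rw [e3]
      have i5 : (Λ₁ + Λ₂) * M ^ 2 ≤ (Λ₁ + Λ₂) * (D ^ 2 + E ^ 2) := by gcongr
      norm_num
      nlinarith)
    (by
      have h1 := ((hl₁.sub hl₂).pow 2).add ((h₁.tendsto_b.sub h₂.tendsto_b).pow 2)
      simpa using h1)
  intro r hr
  have h := key r hr
  have hy : y₁ r - y₂ r = 0 := by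
    have : (y₁ r - y₂ r) ^ 2 = 0 := by nlinarith [sq_nonneg (y₁ r - y₂ r), sq_nonneg (b₁ r - b₂ r)]
    exact pow_eq_zero_iff (two_ne_zero) |>.1 this
  have hb : b₁ r - b₂ r = 0 := by
    have : (b₁ r - b₂ r) ^ 2 = 0 := by nlinarith [sq_nonneg (y₁ r - y₂ r), sq_nonneg (b₁ r - b₂ r)]
    exact pow_eq_zero_iff (two_ne_zero) |>.1 this
  refine ⟨?_, by linarith⟩
  simp only [hy₁def, hy₂def] at hy
  have hr0 := hr.1.ne'
  field_simp at hy
  linarith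

end

/-! ### From regular balls to stretch profiles. -/

lemma rad_eq_iff_deriv_stretchRad {lam mu c r a b a' b' : ℝ} (hr : r ≠ 0) (ha : a ≠ 0) (hb : b ≠ 0)
    (htan : r * b' = b * (a - b) / a) :
    r * a' * stretchHyp lam mu a b = 2 * c * r ^ 2 / (a * b ^ 3) + 2 * b * (a - b) *
      ((3 * lam + 2 * mu) - (lam + 2 * mu) * a ^ 2 - 2 * (lam + mu) * (a * b + b ^ 2)) / a ↔
    -(stretchHyp lam mu a b / (2 * b ^ 2)) * a'
        + a / b ^ 3 * ((lam + 2 * mu) * a ^ 2 - (3 * lam + 2 * mu)) * b'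
      = -(2 / r) * (stretchRad lam mu a b - stretchTan lam mu a b) - c * r / (a * b ^ 5) := by
  have hb' : b' = b * (a - b) / a / r := by rw [← htan]; field_simp
  have key : (-(stretchHyp lam mu a b / (2 * b ^ 2)) * a'
        + a / b ^ 3 * ((lam + 2 * mu) * a ^ 2 - (3 * lam + 2 * mu)) * b')
      - (-(2 / r) * (stretchRad lam mu a b - stretchTan lam mu a b) - c * r / (a * b ^ 5))
      = -(r * a' * stretchHyp lam mu a b - (2 * c * r ^ 2 / (a * b ^ 3) + 2 * b * (a - b) *
      ((3 * lam + 2 * mu) - (lam + 2 * mu) * a ^ 2 - 2 * (lam + mu) * (a * b + b ^ 2)) / a))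
        / (2 * b ^ 2 * r) := by
    rw [hb', stretchRad, stretchTan]
    generalize stretchHyp lam mu a b = W
    field_simp
    ring
  constructor
  · intro h
    rw [← sub_eq_zero, key, h, sub_self, neg_zero, zero_div]
  · intro h
    rw [← sub_eq_zero] at h ⊢
    rw [key, div_eq_zero_iff] at h
    exact neg_eq_zero.1 (h.resolve_right (by positivity))

lemma tendsto_zero_right_of_continuousOn {f : ℝ → ℝ} (hR : 0 < R)
    (hf : ContinuousOn f (Icc 0 R)) : Tendsto f (𝓝[>] 0) (𝓝 (f 0)) := by
  refine (hf 0 ⟨le_rfl, hR.le⟩).tendsto.mono_left ?_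
  rw [← nhdsWithin_Ioo_eq_nhdsGT hR]
  exact nhdsWithin_mono _ Ioo_subset_Icc_self

section RegularBall

variable {rho pRad pTan : ℝ → ℝ} {R : ℝ}

lemma IsRegularBall.rho_pos (h : IsRegularBall rho pRad pTan R) :
    ∀ r ∈ Ioo 0 R, 0 < rho r := fun r hr => by
  rw [← h.support_eq] at hr
  exact (interior_subset hr).2

lemma IsRegularBall.continuousAt_rho (h : IsRegularBall rho pRad pTan R) :
    ∀ r ∈ Ioo 0 R, ContinuousAt rho r := fun _ hr =>
  h.rho_cont.continuousAt (Icc_mem_nhds hr.1 hr.2)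

lemma IsRegularBall.hasDerivAt_rho (h : IsRegularBall rho pRad pTan R) :
    ∀ r ∈ Ioo 0 R, HasDerivAt rho (deriv rho r) r := fun r hr =>
  ((h.rho_C1.differentiableOn one_ne_zero r ⟨hr.1, hr.2.le⟩).differentiableAt
    (Ioc_mem_nhds hr.1 hr.2)).hasDerivAt

lemma IsRegularBall.intervalIntegrable (h : IsRegularBall rho pRad pTan R) :
    ∀ r ∈ Icc 0 R, IntervalIntegrable (fun s => rho s * s ^ 2) MeasureTheory.volume 0 r :=
  fun r hr => by
    refine ContinuousOn.intervalIntegrable ?_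
    rw [uIcc_of_le hr.1]
    exact (h.rho_cont.mono (Icc_subset_Icc_right hr.2)).mul (by fun_prop)

lemma IsRegularBall.hasDerivAt_mass (h : IsRegularBall rho pRad pTan R) :
    ∀ r ∈ Ioo 0 R, HasDerivAt (mass rho) (4 * Real.pi * (rho r * r ^ 2)) r := fun r hr => by
  refine (intervalIntegral.integral_hasDerivAt_right (h.intervalIntegrable r ⟨hr.1.le, hr.2.le⟩)
    ?_ ((h.continuousAt_rho r hr).mul (by fun_prop))).const_mul _
  refine ContinuousOn.stronglyMeasurableAtFilter isOpen_Ioo (s := Ioo 0 R) ?_ r hr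
  exact (h.rho_cont.mono Ioo_subset_Icc_self).mul (by fun_prop)

lemma IsRegularBall.mass_pos (h : IsRegularBall rho pRad pTan R) :
    ∀ r ∈ Ioo 0 R, 0 < mass rho r := fun r hr => by
  refine mul_pos (by positivity) (intervalIntegral.intervalIntegral_pos_of_pos_on
    (h.intervalIntegrable r ⟨hr.1.le, hr.2.le⟩) (fun s hs => ?_) hr.1)
  exact mul_pos (h.rho_pos s ⟨hs.1, hs.2.trans hr.2⟩) (pow_pos hs.1 2)

lemma IsRegularBall.tendsto_mass (h : IsRegularBall rho pRad pTan R) :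
    Tendsto (mass rho) (𝓝[>] 0) (𝓝 0) := by
  have h1 : ContinuousOn (fun r => ∫ s in (0 : ℝ)..r, rho s * s ^ 2) (Icc 0 R) := by
    have := intervalIntegral.continuousOn_primitive_interval' (a := 0)
      (h.intervalIntegrable R ⟨h.radius_pos.le, le_rfl⟩) left_mem_uIcc
    rwa [uIcc_of_le h.radius_pos.le] at this
  have h2 : ContinuousOn (mass rho) (Icc 0 R) := continuousOn_const.mul h1
  simpa [mass] using tendsto_zero_right_of_continuousOn h.radius_pos h2

lemma IsRegularBall.tendsto_delta (h : IsRegularBall rho pRad pTan R) (K : ℝ) :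
    Tendsto (delta K rho) (𝓝[>] 0) (𝓝 (rho 0 / K)) :=
  (tendsto_zero_right_of_continuousOn h.radius_pos h.rho_cont).div_const K

/-- By l'Hôpital's rule, as the quotient of the derivatives of numerator and denominator is δ. -/
lemma IsRegularBall.tendsto_eta (h : IsRegularBall rho pRad pTan R) {K : ℝ} (hK : 0 < K) :
    Tendsto (eta K rho) (𝓝[>] 0) (𝓝 (rho 0 / K)) := by
  have hd : ∀ r ∈ Ioo 0 R, HasDerivAt (fun r : ℝ => 4 * Real.pi / 3 * K * r ^ 3)
      (4 * Real.pi * K * r ^ 2) r := fun r _ => by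
    refine ((hasDerivAt_pow 3 r).const_mul (4 * Real.pi / 3 * K)).congr_deriv ?_
    push_cast; ring
  refine HasDerivAt.lhopital_zero_right_on_Ioo h.radius_pos h.hasDerivAt_mass hd ?_
    h.tendsto_mass ?_ ?_
  · intro r hr
    have := hr.1
    positivity
  · have : Tendsto (fun r : ℝ => 4 * Real.pi / 3 * K * r ^ 3) (𝓝 0)
      (𝓝 (4 * Real.pi / 3 * K * 0 ^ 3)) :=
      (by fun_prop : Continuous fun r : ℝ => 4 * Real.pi / 3 * K * r ^ 3).tendsto 0
    simp only [ne_eq, OfNat.ofNat_ne_zero, not_false_eq_true, zero_pow, mul_zero] at this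
    exact this.mono_left nhdsWithin_le_nhds
  · refine (h.tendsto_delta K).congr' ?_
    filter_upwards [self_mem_nhdsWithin] with r hr
    have : (r : ℝ) ≠ 0 := ne_of_gt hr
    rw [delta]
    field_simp

lemma IsRegularBall.delta_pos (h : IsRegularBall rho pRad pTan R) {K : ℝ} (hK : 0 < K) :
    ∀ r ∈ Ioo 0 R, 0 < delta K rho r := fun r hr => div_pos (h.rho_pos r hr) hK

lemma IsRegularBall.eta_pos (h : IsRegularBall rho pRad pTan R) {K : ℝ} (hK : 0 < K) :
    ∀ r ∈ Ioo 0 R, 0 < eta K rho r := fun r hr => by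
  have := hr.1
  exact div_pos (h.mass_pos r hr) (by positivity)

lemma IsRegularBall.hasDerivAt_eta (h : IsRegularBall rho pRad pTan R) {K : ℝ} (hK : 0 < K) :
    ∀ r ∈ Ioo 0 R,
      HasDerivAt (eta K rho) (3 * (delta K rho r - eta K rho r) / r) r := fun r hr => by
  have hr0 := hr.1
  have h1 := (h.hasDerivAt_mass r hr).div
    ((hasDerivAt_pow 3 r).const_mul (4 * Real.pi / 3 * K)) (by positivity)
  refine h1.congr_deriv ?_
  rw [delta, eta]
  push_cast
  field_simp

end RegularBall

section SVKBall

variable {lam mu K : ℝ} {rho pRad pTan : ℝ → ℝ} {R : ℝ}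

lemma IsRegularSVKBall.pRad_eq (h : IsRegularSVKBall lam mu K rho pRad pTan R) (hK : 0 < K) :
    ∀ r ∈ Ioo 0 R, pRad r = stretchRad lam mu (radStretch (delta K rho r) (eta K rho r))
      (tanStretch (eta K rho r)) := fun r hr => by
  rw [h.2.pRad_eq r hr, svkRad_eq lam mu (h.1.delta_pos hK r hr) (h.1.eta_pos hK r hr)]

lemma IsRegularSVKBall.pTan_eq (h : IsRegularSVKBall lam mu K rho pRad pTan R) (hK : 0 < K) :
    ∀ r ∈ Ioo 0 R, pTan r = stretchTan lam mu (radStretch (delta K rho r) (eta K rho r))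
      (tanStretch (eta K rho r)) := fun r hr => by
  rw [h.2.pTan_eq r hr, svkTan_eq lam mu (h.1.delta_pos hK r hr) (h.1.eta_pos hK r hr)]

lemma stretchRad_pos_iff {a b : ℝ} (ha : 0 < a) (hb : 0 < b) :
    0 < stretchRad lam mu a b ↔
      (lam + 2 * mu) * a ^ 2 + 2 * lam * b ^ 2 < 3 * lam + 2 * mu := by
  rw [stretchRad, mul_pos_iff_of_pos_left (by positivity)]
  constructor <;> intro h <;> linarith

lemma stretchTan_pos_iff {a b : ℝ} (ha : 0 < a) :
    0 < stretchTan lam mu a b ↔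
      lam * a ^ 2 + 2 * (lam + mu) * b ^ 2 < 3 * lam + 2 * mu := by
  rw [stretchTan, mul_pos_iff_of_pos_left (by positivity)]
  constructor <;> intro h <;> linarith

/-- For λ ≥ 0 the tangential condition suffices. For λ < 0, adding -λ times the radial and λ+2μ
times the tangential condition eliminates a² and leaves 2μ(3λ+2μ)(b²-1) < 0. -/
lemma tanStretch_bound_of_pressures (hmu : 0 ≤ mu) (hbulk : 0 < 3 * lam + 2 * mu) :
    ∃ M : ℝ, ∀ a b : ℝ,
      (lam + 2 * mu) * a ^ 2 + 2 * lam * b ^ 2 < 3 * lam + 2 * mu →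
      lam * a ^ 2 + 2 * (lam + mu) * b ^ 2 < 3 * lam + 2 * mu → b ^ 2 ≤ M := by
  have hL : 0 < lam + 2 * mu := by linarith
  have hlm : 0 < lam + mu := by linarith
  rcases lt_or_ge lam 0 with hlam | hlam
  · refine ⟨1, fun a b h1 h2 => ?_⟩
    have hmu' : 0 < mu := by linarith
    have h3 := mul_lt_mul_of_pos_left h1 (neg_pos.2 hlam)
    have h4 := mul_lt_mul_of_pos_left h2 hL
    have h5 : 2 * mu * (3 * lam + 2 * mu) * (b ^ 2 - 1) < 0 := by nlinarith
    by_contra! h6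
    have : 0 < 2 * mu * (3 * lam + 2 * mu) * (b ^ 2 - 1) := by
      have := sub_pos.2 h6
      positivity
    linarith
  · refine ⟨(3 * lam + 2 * mu) / (2 * (lam + mu)), fun a b _ h2 => ?_⟩
    rw [le_div_iff₀ (by positivity)]
    nlinarith [mul_nonneg hlam (sq_nonneg a)]

/-- The definition of a ball does not exclude a vanishing central density. Positive pressures bound
b, so η = b⁻³ stays away from 0, and η tends to δ_c. -/
lemma IsRegularSVKBall.center_pos (hmu : 0 ≤ mu) (hbulk : 0 < 3 * lam + 2 * mu) (hK : 0 < K)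
    (h : IsRegularSVKBall lam mu K rho pRad pTan R) : 0 < rho 0 / K := by
  obtain ⟨M, hM⟩ := tanStretch_bound_of_pressures hmu hbulk
  have hlow : ∀ r ∈ Ioo 0 R, 1 ≤ eta K rho r ^ 2 * M ^ 3 := fun r hr => by
    have hd := h.1.delta_pos hK r hr
    have he := h.1.eta_pos hK r hr
    have h1 := h.1.pRad_pos r ⟨hr.1.le, hr.2⟩
    have h2 := h.1.pTan_pos r ⟨hr.1.le, hr.2⟩
    rw [h.pRad_eq hK r hr, stretchRad_pos_iff (radStretch_pos hd he) (tanStretch_pos he)] at h1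
    rw [h.pTan_eq hK r hr, stretchTan_pos_iff (radStretch_pos hd he)] at h2
    have h3 := hM _ _ h1 h2
    have h4 := mul_tanStretch_pow_three he
    calc (1 : ℝ) = (eta K rho r * tanStretch (eta K rho r) ^ 3) ^ 2 := by rw [h4]; norm_num
      _ = eta K rho r ^ 2 * (tanStretch (eta K rho r) ^ 2) ^ 3 := by ring
      _ ≤ eta K rho r ^ 2 * M ^ 3 := by gcongr
  have hlim := ((h.1.tendsto_eta hK).pow 2).mul_const (M ^ 3)
  have h5 : 1 ≤ (rho 0 / K) ^ 2 * M ^ 3 := by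
    refine ge_of_tendsto hlim ?_
    filter_upwards [Ioo_mem_nhdsGT h.1.radius_pos] with r hr
    exact hlow r hr
  have h6 : 0 ≤ rho 0 / K := by
    refine ge_of_tendsto (h.1.tendsto_delta K) ?_
    filter_upwards [Ioo_mem_nhdsGT h.1.radius_pos] with r hr
    exact (h.1.delta_pos hK r hr).le
  refine h6.lt_of_ne fun h7 => ?_
  rw [← h7] at h5
  norm_num at h5

lemma IsRegularSVKBall.tendsto_tanStretch (hmu : 0 ≤ mu) (hbulk : 0 < 3 * lam + 2 * mu)
    (hK : 0 < K) (h : IsRegularSVKBall lam mu K rho pRad pTan R) :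
    Tendsto (fun r => tanStretch (eta K rho r)) (𝓝[>] 0) (𝓝 (tanStretch (rho 0 / K))) :=
  (hasDerivAt_tanStretch (h.center_pos hmu hbulk hK)).continuousAt.tendsto.comp
    (h.1.tendsto_eta hK)

lemma IsRegularSVKBall.tendsto_radStretch (hmu : 0 ≤ mu) (hbulk : 0 < 3 * lam + 2 * mu)
    (hK : 0 < K) (h : IsRegularSVKBall lam mu K rho pRad pTan R) :
    Tendsto (fun r => radStretch (delta K rho r) (eta K rho r)) (𝓝[>] 0)
      (𝓝 (tanStretch (rho 0 / K))) := by
  have h0 := h.center_pos hmu hbulk hK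
  rw [← radStretch_self h0]
  exact ((h.1.tendsto_eta hK).mul (h.tendsto_tanStretch hmu hbulk hK)).div
    (h.1.tendsto_delta K) h0.ne'

lemma tendsto_stretchRad {a b : ℝ → ℝ} {β : ℝ} {l : Filter ℝ} (hβ : 0 < β)
    (ha : Tendsto a l (𝓝 β)) (hb : Tendsto b l (𝓝 β)) :
    Tendsto (fun r => stretchRad lam mu (a r) (b r)) l (𝓝 (stretchRad lam mu β β)) :=
  (ha.div ((hb.pow 2).const_mul 2) (by positivity)).mul
    ((((ha.pow 2).const_mul _).const_sub _).sub ((hb.pow 2).const_mul _))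

/-- The central density of a regular Saint Venant-Kirchhoff ball exceeds the reference density. -/
theorem IsRegularSVKBall.one_lt_center (hmu : 0 ≤ mu) (hbulk : 0 < 3 * lam + 2 * mu) (hK : 0 < K)
    (h : IsRegularSVKBall lam mu K rho pRad pTan R) : 1 < rho 0 / K := by
  have h0 := h.center_pos hmu hbulk hK
  have hβ := tanStretch_pos h0
  have h1 : Tendsto pRad (𝓝[>] 0)
      (𝓝 (stretchRad lam mu (tanStretch (rho 0 / K)) (tanStretch (rho 0 / K)))) := by
    refine (tendsto_stretchRad hβ (h.tendsto_radStretch hmu hbulk hK)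
      (h.tendsto_tanStretch hmu hbulk hK)).congr' ?_
    filter_upwards [Ioo_mem_nhdsGT h.1.radius_pos] with r hr
    exact (h.pRad_eq hK r hr).symm
  have h2 := tendsto_nhds_unique h1
    (tendsto_zero_right_of_continuousOn h.1.radius_pos h.1.pRad_cont)
  have h3 := h.1.pRad_pos 0 ⟨le_rfl, h.1.radius_pos⟩
  rw [← h2, stretchRad_pos_iff hβ hβ] at h3
  rw [← tanStretch_lt_one_iff h0]
  by_contra! h4
  have h5 : 1 ≤ tanStretch (rho 0 / K) ^ 2 := one_le_pow₀ h4
  nlinarith [mul_le_mul_of_nonneg_left h5 hbulk.le]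

/-- The stretches of a regular Saint Venant-Kirchhoff ball solve the static equations. -/
theorem IsRegularSVKBall.exists_isInnerProfile (hmu : 0 ≤ mu) (hbulk : 0 < 3 * lam + 2 * mu)
    (hK : 0 < K) (h : IsRegularSVKBall lam mu K rho pRad pTan R) :
    ∃ a' b' : ℝ → ℝ, IsInnerProfile lam mu (4 * Real.pi / 3 * K ^ 2) (tanStretch (rho 0 / K))
      (fun r => radStretch (delta K rho r) (eta K rho r)) (fun r => tanStretch (eta K rho r))
      a' b' R := by
  have hb : ∀ r ∈ Ioo 0 R, HasDerivAt (fun r => tanStretch (eta K rho r))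
      (-(tanStretch (eta K rho r) / (3 * eta K rho r)) *
        (3 * (delta K rho r - eta K rho r) / r)) r := fun r hr =>
    (hasDerivAt_tanStretch (h.1.eta_pos hK r hr)).comp r (h.1.hasDerivAt_eta hK r hr)
  have ha : ∀ r ∈ Ioo 0 R, HasDerivAt (fun r => radStretch (delta K rho r) (eta K rho r))
      (deriv (fun r => radStretch (delta K rho r) (eta K rho r)) r) r := fun r hr =>
    (((h.1.hasDerivAt_eta hK r hr).mul (hb r hr)).div ((h.1.hasDerivAt_rho r hr).div_const K)
      (h.1.delta_pos hK r hr).ne').differentiableAt.hasDerivAt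
  refine ⟨_, _, ha, hb, fun r hr => radStretch_pos (h.1.delta_pos hK r hr) (h.1.eta_pos hK r hr),
    fun r hr => tanStretch_pos (h.1.eta_pos hK r hr), fun r hr => ?_,
    h.tendsto_radStretch hmu hbulk hK, h.tendsto_tanStretch hmu hbulk hK, fun r hr => ?_⟩
  · have hd := h.1.delta_pos hK r hr
    have he := h.1.eta_pos hK r hr
    have hap := radStretch_pos hd he
    have hbp := tanStretch_pos he
    have hr0 := hr.1
    have htan : r * (-(tanStretch (eta K rho r) / (3 * eta K rho r)) *
        (3 * (delta K rho r - eta K rho r) / r)) = tanStretch (eta K rho r) *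
          (radStretch (delta K rho r) (eta K rho r) - tanStretch (eta K rho r)) /
          radStretch (delta K rho r) (eta K rho r) := by
      rw [radStretch]
      field_simp
      ring
    refine ⟨htan, (rad_eq_iff_deriv_stretchRad hr0.ne' hap.ne' hbp.ne' htan).2 ?_⟩
    obtain ⟨Phi, hPhi⟩ := h.1.system
    obtain ⟨hp1, hp2⟩ := hPhi r hr
    rw [hp1.deriv, h.pRad_eq hK r hr, h.pTan_eq hK r hr] at hp2
    have h1 := hasDerivAt_stretchRad lam mu (ha r hr) (hb r hr) hbp.ne'
    have h2 : HasDerivAt pRad _ r := h1.congr_of_eventuallyEq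
      (Filter.mem_of_superset (Ioo_mem_nhds hr.1 hr.2) fun s hs => h.pRad_eq hK s hs)
    rw [h2.unique hp2]
    -- Only the gravitational terms remain: ρ m/r² = c r/(a b⁵) with c = (4π/3)K².
    congr 1
    have e1 : rho r = K * delta K rho r := by rw [delta]; field_simp
    have e2 : mass rho r = 4 * Real.pi / 3 * K * r ^ 3 * eta K rho r := by rw [eta]; field_simp
    rw [e1, e2, radStretch]
    have e3 : eta K rho r = 1 / tanStretch (eta K rho r) ^ 3 := by
      rw [tanStretch_pow_three he]; field_simp
    generalize tanStretch (eta K rho r) = b at *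
    generalize eta K rho r = e at *
    subst e3
    field_simp
  · have h1 := h.1.pRad_pos r ⟨hr.1.le, hr.2⟩
    rwa [h.pRad_eq hK r hr, stretchRad_pos_iff
      (radStretch_pos (h.1.delta_pos hK r hr) (h.1.eta_pos hK r hr))
      (tanStretch_pos (h.1.eta_pos hK r hr))] at h1

end SVKBall

/-! ### Uniqueness of balls, and the ball defined by a profile. -/

section

variable {lam mu K : ℝ}

/-- Two regular Saint Venant-Kirchhoff balls with the same reference and central densities
coincide, if the central state is strictly hyperbolic. -/
theorem IsRegularSVKBall.unique (hmu : 0 ≤ mu) (hbulk : 0 < 3 * lam + 2 * mu) (hK : 0 < K)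
    {rho pRad pTan rho' pRad' pTan' : ℝ → ℝ} {R R' : ℝ}
    (h : IsRegularSVKBall lam mu K rho pRad pTan R)
    (h' : IsRegularSVKBall lam mu K rho' pRad' pTan' R') (h0 : rho' 0 = rho 0)
    (hyp : 0 < stretchHyp lam mu (tanStretch (rho 0 / K)) (tanStretch (rho 0 / K))) :
    R' = R ∧ ∀ r, 0 ≤ r → rho' r = rho r ∧ pRad' r = pRad r ∧ pTan' r = pTan r := by
  obtain ⟨_, _, hp⟩ := h.exists_isInnerProfile hmu hbulk hK
  obtain ⟨_, _, hp'⟩ := h'.exists_isInnerProfile hmu hbulk hK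
  rw [h0] at hp'
  have hβ := tanStretch_pos (h.center_pos hmu hbulk hK)
  have hR := h.1.radius_pos
  have hR' := h'.1.radius_pos
  have hpos : 0 < min R R' := lt_min hR hR'
  have hIoo : ∀ r ∈ Ioo 0 (min R R'), rho' r = rho r ∧ pRad' r = pRad r ∧ pTan' r = pTan r := by
    intro r hr
    have hr1 : r ∈ Ioo 0 R := ⟨hr.1, hr.2.trans_le (min_le_left _ _)⟩
    have hr2 : r ∈ Ioo 0 R' := ⟨hr.1, hr.2.trans_le (min_le_right _ _)⟩
    obtain ⟨e1, e2⟩ := IsInnerProfile.unique hmu hbulk (by positivity) hβ hyp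
      (hp.mono (min_le_left R R')) (hp'.mono (min_le_right R R')) r hr
    have hd := one_div_radStretch_mul (h.1.delta_pos hK r hr1) (h.1.eta_pos hK r hr1)
    have hd' := one_div_radStretch_mul (h'.1.delta_pos hK r hr2) (h'.1.eta_pos hK r hr2)
    refine ⟨?_, ?_, ?_⟩
    · rw [← e1, ← e2, hd, delta, delta, div_left_inj' hK.ne'] at hd'
      exact hd'.symm
    · rw [h.pRad_eq hK r hr1, h'.pRad_eq hK r hr2, e1, e2]
    · rw [h.pTan_eq hK r hr1, h'.pTan_eq hK r hr2, e1, e2]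
  have hcl : ∀ f g : ℝ → ℝ, ContinuousOn f (Icc 0 R') → ContinuousOn g (Icc 0 R) →
      EqOn f g (Ioo 0 (min R R')) → EqOn f g (Icc 0 (min R R')) := fun f g hf hg hfg =>
    hfg.of_subset_closure (hf.mono (Icc_subset_Icc_right (min_le_right _ _)))
      (hg.mono (Icc_subset_Icc_right (min_le_left _ _))) Ioo_subset_Icc_self
      (by rw [closure_Ioo hpos.ne])
  have hrho := hcl _ _ h'.1.rho_cont h.1.rho_cont fun r hr => (hIoo r hr).1
  have hrad := hcl _ _ h'.1.pRad_cont h.1.pRad_cont fun r hr => (hIoo r hr).2.1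
  have htan := hcl _ _ h'.1.pTan_cont h.1.pTan_cont fun r hr => (hIoo r hr).2.2
  -- The radial pressures agree up to the smaller radius, where one vanishes; were the other radius
  -- larger, the other pressure would still be positive there.
  have hRR : R' = R := by
    have hend := hrad (right_mem_Icc.2 hpos.le)
    rcases lt_trichotomy R' R with hlt | heq | hgt
    · rw [min_eq_right hlt.le, h'.1.pRad_boundary] at hend
      exact absurd (h.1.pRad_pos R' ⟨hR'.le, hlt⟩) (by rw [← hend]; exact lt_irrefl _)
    · exact heq
    · rw [min_eq_left hgt.le, h.1.pRad_boundary] at hend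
      exact absurd (h'.1.pRad_pos R ⟨hR.le, hgt⟩) (by rw [hend]; exact lt_irrefl _)
  refine ⟨hRR, fun r hr => ?_⟩
  rcases le_or_gt r R with hle | hgt
  · have hm : r ∈ Icc 0 (min R R') := ⟨hr, le_min hle (hle.trans_eq hRR.symm)⟩
    exact ⟨hrho hm, hrad hm, htan hm⟩
  · obtain ⟨i1, i2, i3⟩ := h.1.vacuum r hgt
    obtain ⟨j1, j2, j3⟩ := h'.1.vacuum r (hRR.trans_lt hgt)
    exact ⟨j1.trans i1.symm, j2.trans i2.symm, j3.trans i3.symm⟩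

/-- The extension by zero outside the ball of radius `R` of a function of the stretches. -/
def stretchField (a b : ℝ → ℝ) (R : ℝ) (G : ℝ × ℝ → ℝ) (r : ℝ) : ℝ :=
  if r ≤ R then G (a r, b r) else 0

/-- The density of the ball with reference density `K` and given stretches. -/
def stretchDensity (K : ℝ) (q : ℝ × ℝ) : ℝ := K / (q.1 * q.2 ^ 2)

lemma stretchField_of_le {a b : ℝ → ℝ} {R r : ℝ} (G : ℝ × ℝ → ℝ) (hr : r ≤ R) :
    stretchField a b R G r = G (a r, b r) := if_pos hr

lemma contDiffOn_stretchDensity (K : ℝ) : ContDiffOn ℝ 1 (stretchDensity K) (Ioi 0 ×ˢ Ioi 0) := by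
  unfold stretchDensity
  refine ContDiffOn.div (by fun_prop) (by fun_prop) fun q hq => ?_
  have h1 : 0 < q.1 := hq.1
  have h2 : 0 < q.2 := hq.2
  positivity

/-- Positive radial pressure and b ≤ a force b < 1. For λ < 0 bound λa² by λb²; for λ ≥ 0 the
tangential bracket times λ+2μ is λ times the radial one plus 2μ(3λ+2μ)(1-b²). -/
lemma stretchTan_pos_of_stretchRad_pos (hmu : 0 ≤ mu) (hbulk : 0 < 3 * lam + 2 * mu) {a b : ℝ}
    (hb : 0 < b) (hab : b ≤ a) (h : 0 < stretchRad lam mu a b) : 0 < stretchTan lam mu a b := by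
  have ha : 0 < a := hb.trans_le hab
  rw [stretchRad_pos_iff ha hb] at h
  rw [stretchTan_pos_iff ha]
  have hL : 0 < lam + 2 * mu := by linarith
  have h1 : b ^ 2 ≤ a ^ 2 := by gcongr
  have h2 : b ^ 2 < 1 := by nlinarith
  rcases lt_or_ge lam 0 with hlam | hlam
  · nlinarith
  · have key : 0 < (lam + 2 * mu) * ((3 * lam + 2 * mu)
        - (lam * a ^ 2 + 2 * (lam + mu) * b ^ 2)) := by
      have e : (lam + 2 * mu) * ((3 * lam + 2 * mu) - (lam * a ^ 2 + 2 * (lam + mu) * b ^ 2))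
          = lam * ((3 * lam + 2 * mu) - ((lam + 2 * mu) * a ^ 2 + 2 * lam * b ^ 2))
            + 2 * (mu * ((3 * lam + 2 * mu) * (1 - b ^ 2))) := by ring
      have h3 : 0 < (3 * lam + 2 * mu) * (1 - b ^ 2) := mul_pos hbulk (sub_pos.2 h2)
      rw [e]
      rcases hlam.eq_or_lt with hz | hp
      · have hmu' : 0 < mu := by linarith
        rw [← hz] at h3 ⊢
        have := mul_pos hmu' h3
        linarith
      · have := mul_pos hp (sub_pos.2 h)
        have := mul_nonneg hmu h3.le
        linarith
    linarith [(mul_pos_iff_of_pos_left hL).1 key]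

section Ball

variable {c β : ℝ} {a b a' b' : ℝ → ℝ} {R : ℝ}

lemma IsStretchProfile.le_b (h : IsStretchProfile lam mu c β a b a' b' R) :
    ∀ r ∈ Icc 0 R, β ≤ b r := fun r hr => by
  rcases hr.1.eq_or_lt with h0 | h0
  · rw [← h0, h.b_zero]
  · exact (h.lt_b r ⟨h0, hr.2⟩).le

lemma IsStretchProfile.b_le_a (h : IsStretchProfile lam mu c β a b a' b' R) :
    ∀ r ∈ Icc 0 R, b r ≤ a r := fun r hr => by
  rcases hr.1.eq_or_lt with h0 | h0
  · rw [← h0, h.b_zero, h.a_zero]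
  · exact (h.b_lt_a r ⟨h0, hr.2⟩).le

lemma IsStretchProfile.b_pos (h : IsStretchProfile lam mu c β a b a' b' R) (hβ : 0 < β) :
    ∀ r ∈ Icc 0 R, 0 < b r := fun r hr => hβ.trans_le (h.le_b r hr)

lemma IsStretchProfile.a_pos (h : IsStretchProfile lam mu c β a b a' b' R) (hβ : 0 < β) :
    ∀ r ∈ Icc 0 R, 0 < a r := fun r hr => (h.b_pos hβ r hr).trans_le (h.b_le_a r hr)

lemma IsStretchProfile.b_lt_one (hmu : 0 ≤ mu) (hbulk : 0 < 3 * lam + 2 * mu)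
    (h : IsStretchProfile lam mu c β a b a' b' R) (hβ : 0 < β) :
    ∀ r ∈ Ioc 0 R, b r < 1 := fun r hr => by
  have hb := h.b_pos hβ r ⟨hr.1.le, hr.2⟩
  have hab := h.b_lt_a r hr
  have hle : (lam + 2 * mu) * a r ^ 2 + 2 * lam * b r ^ 2 ≤ 3 * lam + 2 * mu := by
    rcases hr.2.eq_or_lt with h1 | h1
    · rw [h1, h.boundary]
    · exact (h.interior r ⟨hr.1.le, h1⟩).le
  have h1 : b r ^ 2 < a r ^ 2 := by gcongr
  have hL : 0 < lam + 2 * mu := by linarith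
  by_contra! h2
  have h3 : 1 ≤ b r ^ 2 := one_le_pow₀ h2
  nlinarith [mul_pos hL (sub_pos.2 h1), mul_nonneg hbulk.le (sub_nonneg.2 h3)]

lemma IsStretchProfile.contDiff_a (h : IsStretchProfile lam mu c β a b a' b' R) :
    ContDiff ℝ 1 a := by
  rw [contDiff_one_iff_deriv]
  refine ⟨fun r => (h.hasDerivAt_a r).differentiableAt, ?_⟩
  rw [show deriv a = a' from funext fun r => (h.hasDerivAt_a r).deriv]
  exact h.cont_a'

lemma IsStretchProfile.contDiff_b (h : IsStretchProfile lam mu c β a b a' b' R) :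
    ContDiff ℝ 1 b := by
  rw [contDiff_one_iff_deriv]
  refine ⟨fun r => (h.hasDerivAt_b r).differentiableAt, ?_⟩
  rw [show deriv b = b' from funext fun r => (h.hasDerivAt_b r).deriv]
  exact h.cont_b'

lemma IsStretchProfile.contDiffOn_stretchField (h : IsStretchProfile lam mu c β a b a' b' R)
    (hβ : 0 < β) {G : ℝ × ℝ → ℝ} (hG : ContDiffOn ℝ 1 G (Ioi 0 ×ˢ Ioi 0)) :
    ContDiffOn ℝ 1 (stretchField a b R G) (Icc 0 R) :=
  (hG.comp (h.contDiff_a.prodMk h.contDiff_b).contDiffOn fun r hr =>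
    ⟨h.a_pos hβ r hr, h.b_pos hβ r hr⟩).congr fun _ hr => stretchField_of_le G hr.2

/-- By the chain rule, since a'(0) = b'(0) = 0 and the derivative of the composite is continuous at
0. -/
lemma IsStretchProfile.tendsto_deriv_stretchField
    (h : IsStretchProfile lam mu c β a b a' b' R)
    (hβ : 0 < β) {G : ℝ × ℝ → ℝ} (hG : ContDiffOn ℝ 1 G (Ioi 0 ×ˢ Ioi 0)) :
    Tendsto (deriv (stretchField a b R G)) (𝓝[>] 0) (𝓝 0) := by
  have h0 : (a 0, b 0) = (β, β) := by rw [h.a_zero, h.b_zero]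
  have hG0 : ContDiffAt ℝ 1 G (a 0, b 0) := by
    rw [h0]
    exact hG.contDiffAt (prod_mem_nhds (Ioi_mem_nhds hβ) (Ioi_mem_nhds hβ))
  have hder : deriv (fun r => G (a r, b r)) 0 = 0 := by
    have h1 := (h.hasDerivAt_a 0).prodMk (h.hasDerivAt_b 0)
    rw [h.a'_zero, h.b'_zero] at h1
    have h2 := (hG0.differentiableAt one_ne_zero).hasFDerivAt.comp_hasDerivAt (0 : ℝ) h1
    have h3 := h2.deriv
    rwa [show ((0 : ℝ), (0 : ℝ)) = 0 from rfl, map_zero] at h3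
  have hc : ContinuousAt (deriv fun r => G (a r, b r)) 0 := by
    have hU : IsOpen {r | 0 < a r ∧ 0 < b r} :=
      (isOpen_lt continuous_const h.contDiff_a.continuous).inter
        (isOpen_lt continuous_const h.contDiff_b.continuous)
    have hcomp : ContDiffOn ℝ 1 (fun r => G (a r, b r)) {r | 0 < a r ∧ 0 < b r} :=
      hG.comp (h.contDiff_a.prodMk h.contDiff_b).contDiffOn fun r hr => hr
    refine (hcomp.continuousOn_deriv_of_isOpen hU le_rfl).continuousAt (hU.mem_nhds ?_)
    exact ⟨by rwa [h.a_zero], by rwa [h.b_zero]⟩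
  have hlim := hc.tendsto.mono_left (nhdsWithin_le_nhds (s := Ioi 0))
  rw [hder] at hlim
  refine hlim.congr' ?_
  filter_upwards [Ioo_mem_nhdsGT h.radius_pos] with r hr
  refine Filter.EventuallyEq.deriv_eq ?_
  filter_upwards [Iio_mem_nhds hr.2] with s hs
  exact (stretchField_of_le G (le_of_lt hs)).symm

/-- The tangential equation says exactly that K s³/(3b³) is an antiderivative of ρs². So b is the
tangential stretch of the density built from a and b. -/
lemma IsStretchProfile.mass_eq (h : IsStretchProfile lam mu c β a b a' b' R) (hβ : 0 < β)
    {r : ℝ} (hr : r ∈ Icc 0 R) :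
    mass (stretchField a b R (stretchDensity K)) r = 4 * Real.pi / 3 * K * r ^ 3 / b r ^ 3 := by
  have hsub : ∀ s ∈ uIcc 0 r, s ∈ Icc 0 R := fun s hs => by
    rw [uIcc_of_le hr.1] at hs
    exact ⟨hs.1, hs.2.trans hr.2⟩
  have hd : ∀ s ∈ uIcc 0 r, HasDerivAt (fun s => K * s ^ 3 / (3 * b s ^ 3))
      (stretchField a b R (stretchDensity K) s * s ^ 2) s := fun s hs => by
    have hs' := hsub s hs
    have hb := h.b_pos hβ s hs'
    have ha := h.a_pos hβ s hs'
    have h1 := ((hasDerivAt_pow 3 s).const_mul K).div (((h.hasDerivAt_b s).pow 3).const_mul 3)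
      (by simpa using hb.ne')
    refine h1.congr_deriv ?_
    rw [stretchField_of_le _ hs'.2, stretchDensity]
    simp only [Pi.pow_apply]
    rcases hs'.1.eq_or_lt with h0 | h0
    · rw [← h0]; simp
    · have htan := (h.solves s ⟨h0, hs'.2⟩).tan_eq
      have e : b' s = b s * (a s - b s) / a s / s := by rw [← htan]; field_simp
      rw [e]
      push_cast
      field_simp
      ring
  have hint : IntervalIntegrable (fun s => stretchField a b R (stretchDensity K) s * s ^ 2)
      MeasureTheory.volume 0 r := by
    refine ContinuousOn.intervalIntegrable (ContinuousOn.mul ?_ (by fun_prop))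
    exact (h.contDiffOn_stretchField hβ (contDiffOn_stretchDensity K)).continuousOn.mono hsub
  rw [mass, intervalIntegral.integral_eq_sub_of_hasDerivAt hd hint]
  have hb := h.b_pos hβ r hr
  field_simp
  simp

lemma IsStretchProfile.delta_eq (hK : 0 < K) {r : ℝ} (hr : r ∈ Ioc 0 R) :
    delta K (stretchField a b R (stretchDensity K)) r = 1 / (a r * b r ^ 2) := by
  rw [delta, stretchField_of_le _ hr.2, stretchDensity]
  field_simp

lemma IsStretchProfile.eta_eq (h : IsStretchProfile lam mu c β a b a' b' R) (hβ : 0 < β)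
    (hK : 0 < K) {r : ℝ} (hr : r ∈ Ioc 0 R) :
    eta K (stretchField a b R (stretchDensity K)) r = 1 / b r ^ 3 := by
  have hr0 := hr.1
  rw [eta, h.mass_eq hβ ⟨hr.1.le, hr.2⟩]
  have := h.b_pos hβ r ⟨hr.1.le, hr.2⟩
  field_simp

/-- A solution of the static equations for the stretches defines a strongly regular ball. -/
theorem IsStretchProfile.isStronglyRegularSVKBall (hmu : 0 ≤ mu) (hbulk : 0 < 3 * lam + 2 * mu)
    (hK : 0 < K) (hβ : 0 < β)
    (h : IsStretchProfile lam mu (4 * Real.pi / 3 * K ^ 2) β a b a' b' R) :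
    IsStronglyRegularSVKBall lam mu K (stretchField a b R (stretchDensity K))
      (stretchField a b R fun q => stretchRad lam mu q.1 q.2)
      (stretchField a b R fun q => stretchTan lam mu q.1 q.2) R := by
  have hG₁ := contDiffOn_stretchDensity K
  have hG₂ : ContDiffOn ℝ 1 (fun q : ℝ × ℝ => stretchRad lam mu q.1 q.2) (Ioi 0 ×ˢ Ioi 0) :=
    ContDiffOn.stretchRad lam mu contDiff_fst.contDiffOn contDiff_snd.contDiffOn
      fun q hq => ne_of_gt hq.2
  have hG₃ : ContDiffOn ℝ 1 (fun q : ℝ × ℝ => stretchTan lam mu q.1 q.2) (Ioi 0 ×ˢ Ioi 0) :=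
    ContDiffOn.stretchTan lam mu contDiff_fst.contDiffOn contDiff_snd.contDiffOn
      fun q hq => ne_of_gt hq.1
  have hC₁ := h.contDiffOn_stretchField hβ hG₁
  have hC₂ := h.contDiffOn_stretchField hβ hG₂
  have hC₃ := h.contDiffOn_stretchField hβ hG₃
  have hradpos : ∀ r ∈ Ico 0 R, 0 < stretchRad lam mu (a r) (b r) := fun r hr =>
    (stretchRad_pos_iff (h.a_pos hβ r ⟨hr.1, hr.2.le⟩) (h.b_pos hβ r ⟨hr.1, hr.2.le⟩)).2
      (h.interior r hr)
  have hst : ∀ r ∈ Ioo 0 R, radStretch (delta K (stretchField a b R (stretchDensity K)) r)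
      (eta K (stretchField a b R (stretchDensity K)) r) = a r ∧
      tanStretch (eta K (stretchField a b R (stretchDensity K)) r) = b r := fun r hr => by
    have hr' : r ∈ Ioc 0 R := ⟨hr.1, hr.2.le⟩
    have ha := h.a_pos hβ r ⟨hr.1.le, hr.2.le⟩
    have hb := h.b_pos hβ r ⟨hr.1.le, hr.2.le⟩
    rw [IsStretchProfile.delta_eq hK hr', h.eta_eq hβ hK hr', radStretch_one_div ha hb,
      tanStretch_one_div_pow_three hb]
    exact ⟨rfl, rfl⟩
  have hde : ∀ r ∈ Ioo 0 R, 0 < delta K (stretchField a b R (stretchDensity K)) r ∧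
      0 < eta K (stretchField a b R (stretchDensity K)) r := fun r hr => by
    have hr' : r ∈ Ioc 0 R := ⟨hr.1, hr.2.le⟩
    have ha := h.a_pos hβ r ⟨hr.1.le, hr.2.le⟩
    have hb := h.b_pos hβ r ⟨hr.1.le, hr.2.le⟩
    rw [IsStretchProfile.delta_eq hK hr', h.eta_eq hβ hK hr']
    constructor <;> positivity
  refine ⟨⟨⟨h.radius_pos, ?_, hC₁.continuousOn, hC₂.continuousOn, hC₃.continuousOn,
    hC₁.mono Ioc_subset_Icc_self, hC₂.mono Ioc_subset_Icc_self, hC₃.mono Ioc_subset_Icc_self,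
    ?_, fun r hr => ?_, fun r hr => ?_, ?_, ?_, fun r hr => ?_⟩, hC₁, hC₂, hC₃,
    h.tendsto_deriv_stretchField hβ hG₁, h.tendsto_deriv_stretchField hβ hG₂,
    h.tendsto_deriv_stretchField hβ hG₃⟩,
    ⟨contDiffOn_svkRad lam mu, contDiffOn_svkTan lam mu, fun r hr => ?_, fun r hr => ?_⟩⟩
  -- The density is still positive at the surface r = R; taking the interior removes that point.
  · have : {r : ℝ | 0 < r ∧ 0 < stretchField a b R (stretchDensity K) r} = Ioc 0 R := by
      ext r
      constructor
      · rintro ⟨h1, h2⟩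
        refine ⟨h1, ?_⟩
        by_contra! h3
        rw [stretchField, if_neg (not_le.2 h3)] at h2
        exact lt_irrefl _ h2
      · intro hr
        have ha := h.a_pos hβ r ⟨hr.1.le, hr.2⟩
        have hb := h.b_pos hβ r ⟨hr.1.le, hr.2⟩
        refine ⟨hr.1, ?_⟩
        rw [stretchField_of_le _ hr.2, stretchDensity]
        positivity
    rw [this, interior_Ioc]
  -- The integrand is m(s)/s² with the mass formula inserted, which is continuous at the center.
  · refine ⟨fun r => ∫ s in (0 : ℝ)..r, 4 * Real.pi / 3 * K * s / b s ^ 3, fun r hr => ?_⟩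
    have hr' : r ∈ Icc 0 R := ⟨hr.1.le, hr.2.le⟩
    have hr0 := hr.1
    have hb := h.b_pos hβ r hr'
    have ha := h.a_pos hβ r hr'
    have hbc : Continuous b := h.contDiff_b.continuous
    have hcont : ContinuousOn (fun s => 4 * Real.pi / 3 * K * s / b s ^ 3) (Icc 0 R) :=
      ContinuousOn.div (by fun_prop) (by fun_prop) fun s hs => by
        have := h.b_pos hβ s hs
        positivity
    have hPhi : HasDerivAt (fun r => ∫ s in (0 : ℝ)..r, 4 * Real.pi / 3 * K * s / b s ^ 3)
        (mass (stretchField a b R (stretchDensity K)) r / r ^ 2) r := by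
      have h1 := intervalIntegral.integral_hasDerivAt_right
        (f := fun s => 4 * Real.pi / 3 * K * s / b s ^ 3) (a := 0) (b := r)
        (ContinuousOn.intervalIntegrable (by
          rw [uIcc_of_le hr.1.le]
          exact hcont.mono (Icc_subset_Icc_right hr.2.le)))
        ((hcont.mono Ioo_subset_Icc_self).stronglyMeasurableAtFilter isOpen_Ioo r hr)
        (hcont.continuousAt (Icc_mem_nhds hr.1 hr.2))
      refine h1.congr_deriv ?_
      rw [h.mass_eq hβ hr']
      field_simp
    refine ⟨hPhi, ?_⟩
    rw [hPhi.deriv, h.mass_eq hβ hr', stretchField_of_le _ hr.2.le, stretchField_of_le _ hr.2.le,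
      stretchField_of_le _ hr.2.le, stretchDensity]
    have hsol := h.solves r ⟨hr.1, hr.2.le⟩
    have h1 := hasDerivAt_stretchRad lam mu (h.hasDerivAt_a r) (h.hasDerivAt_b r) hb.ne'
    rw [(rad_eq_iff_deriv_stretchRad hr0.ne' ha.ne' hb.ne' hsol.tan_eq).1 hsol.rad_eq] at h1
    refine (h1.congr_of_eventuallyEq ?_).congr_deriv ?_
    · filter_upwards [Iio_mem_nhds hr.2] with s hs
      exact stretchField_of_le _ (le_of_lt hs)
    · simp only
      congr 1
      field_simp
  · rw [stretchField_of_le _ hr.2.le]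
    exact hradpos r hr
  · rw [stretchField_of_le _ hr.2.le]
    exact stretchTan_pos_of_stretchRad_pos hmu hbulk (h.b_pos hβ r ⟨hr.1, hr.2.le⟩)
      (h.b_le_a r ⟨hr.1, hr.2.le⟩) (hradpos r hr)
  · rw [stretchField_of_le _ le_rfl]
    simp only [stretchRad]
    have := h.boundary
    rw [show (3 * lam + 2 * mu) - (lam + 2 * mu) * a R ^ 2 - 2 * lam * b R ^ 2 = 0 by linarith,
      mul_zero]
  · rw [stretchField_of_le _ h.radius_pos.le, stretchField_of_le _ h.radius_pos.le]
    simp only [h.a_zero, h.b_zero, stretchRad, stretchTan]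
    field_simp
    ring
  · simp [stretchField, not_le.2 hr]
  · obtain ⟨h1, h2⟩ := hde r hr
    obtain ⟨h3, h4⟩ := hst r hr
    rw [svkRad_eq lam mu h1 h2, h3, h4, stretchField_of_le _ hr.2.le]
  · obtain ⟨h1, h2⟩ := hde r hr
    obtain ⟨h3, h4⟩ := hst r hr
    rw [svkTan_eq lam mu h1 h2, h3, h4, stretchField_of_le _ hr.2.le]

end Ball

end

end ElasticBall

end

/-! ### Assembly of the three assertions. -/

theorem theorem4 (lam mu : ℝ) (hmu : 0 ≤ mu) (hbulk : 0 < 3 * lam + 2 * mu) :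
    -- necessity of `δ_c > 1` for the existence of regular balls
    (∀ (K : ℝ) (rho pRad pTan : ℝ → ℝ) (R : ℝ), 0 < K →
      ElasticBall.IsRegularSVKBall lam mu K rho pRad pTan R → 1 < rho 0 / K) ∧
    -- necessity of `δ_c < Δ_♭` for strict hyperbolicity at the center
    (∀ K rhoc : ℝ, 0 < K → 0 < rhoc →
      ElasticBall.StrictlyHyperbolicAt (ElasticBall.svkRad lam mu) (rhoc / K) (rhoc / K) →
      rhoc / K < ElasticBall.deltaFlat lam mu) ∧
    -- existence, uniqueness and bounds
    (∀ K rhoc : ℝ, 0 < K → 0 < rhoc → 1 < rhoc / K →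
      rhoc / K < ElasticBall.deltaFlat lam mu →
      ElasticBall.StrictlyHyperbolicAt (ElasticBall.svkRad lam mu) (rhoc / K) (rhoc / K) ∧
      ∃ (rho pRad pTan : ℝ → ℝ) (R : ℝ),
        ElasticBall.IsStronglyRegularSVKBall lam mu K rho pRad pTan R ∧
        rho 0 = rhoc ∧
        (∀ (rho' pRad' pTan' : ℝ → ℝ) (R' : ℝ),
          ElasticBall.IsRegularSVKBall lam mu K rho' pRad' pTan' R' → rho' 0 = rhoc →
          R' = R ∧ ∀ r, 0 ≤ r → rho' r = rho r ∧ pRad' r = pRad r ∧ pTan' r = pTan r) ∧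
        (∀ r ∈ Set.Ioc 0 R,
          ElasticBall.StrictlyHyperbolicAt (ElasticBall.svkRad lam mu)
            (ElasticBall.delta K rho r) (ElasticBall.eta K rho r) ∧
          rho r < rhoc ∧
          4 * Real.pi / 3 * max (rho r) K * r ^ 3 < ElasticBall.mass rho r ∧
          ElasticBall.mass rho r < 4 * Real.pi / 3 * rhoc * r ^ 3)) := by
  refine ⟨fun K rho pRad pTan R hK h => h.one_lt_center hmu hbulk hK,
    fun K rhoc hK hrhoc hyp => ?_, fun K rhoc hK hrhoc hgt hlt => ?_⟩
  · have hd : 0 < rhoc / K := div_pos hrhoc hK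
    rw [ElasticBall.strictlyHyperbolicAt_iff lam mu hd hd, ElasticBall.radStretch_self hd] at hyp
    exact (ElasticBall.lt_deltaFlat_iff hmu hbulk hd).2 hyp
  · have hd : 0 < rhoc / K := div_pos hrhoc hK
    have hyp := (ElasticBall.lt_deltaFlat_iff hmu hbulk hd).1 hlt
    have hβ := ElasticBall.tanStretch_pos hd
    have hβ1 := (ElasticBall.tanStretch_lt_one_iff hd).2 hgt
    refine ⟨by rwa [ElasticBall.strictlyHyperbolicAt_iff lam mu hd hd,
      ElasticBall.radStretch_self hd], ?_⟩
    obtain ⟨a, b, a', b', R, h⟩ := ElasticBall.exists_isStretchProfile hmu hbulk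
      (by positivity : 0 < 4 * Real.pi / 3 * K ^ 2) hβ hβ1 hyp
    have hball := h.isStronglyRegularSVKBall hmu hbulk hK hβ
    have hrhoc' : K / ElasticBall.tanStretch (rhoc / K) ^ 3 = rhoc := by
      rw [ElasticBall.tanStretch_pow_three hd]; field_simp
    have hcenter : ElasticBall.stretchField a b R (ElasticBall.stretchDensity K) 0 = rhoc := by
      rw [ElasticBall.stretchField_of_le _ h.radius_pos.le, ElasticBall.stretchDensity, h.a_zero,
        h.b_zero]
      refine Eq.trans ?_ hrhoc'
      ring
    refine ⟨_, _, _, R, hball, hcenter, fun rho' pRad' pTan' R' h' h0 => ?_, fun r hr => ?_⟩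
    · refine ElasticBall.IsRegularSVKBall.unique hmu hbulk hK ⟨hball.1.1, hball.2⟩ h'
        (h0.trans hcenter.symm) ?_
      rwa [hcenter]
    · have hr' : r ∈ Set.Icc 0 R := ⟨hr.1.le, hr.2⟩
      have hr0 := hr.1
      have ha := h.a_pos hβ r hr'
      have hb := h.b_pos hβ r hr'
      -- With η = b⁻³ and δ = 1/(ab²), b < a reads δ < η, b < 1 reads η > 1, and β < b reads η <
      -- δ_c; all density and mass bounds are these three.
      have hba := h.b_lt_a r hr
      have hb1 := h.b_lt_one hmu hbulk hβ r hr
      have hβb := h.lt_b r hr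
      have hρ : ElasticBall.stretchField a b R (ElasticBall.stretchDensity K) r <
          K / b r ^ 3 := by
        rw [ElasticBall.stretchField_of_le _ hr.2, ElasticBall.stretchDensity]
        have : b r ^ 3 < a r * b r ^ 2 := by nlinarith [mul_pos hb hb]
        exact div_lt_div_of_pos_left hK (by positivity) this
      have hK1 : K < K / b r ^ 3 := by
        rw [lt_div_iff₀ (by positivity)]
        have : b r ^ 3 < 1 := pow_lt_one₀ hb.le hb1 (by norm_num)
        nlinarith
      have hη : K / b r ^ 3 < rhoc := by
        rw [← hrhoc']
        exact div_lt_div_of_pos_left hK (by positivity) (by gcongr)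
      have hmass := h.mass_eq (K := K) hβ hr'
      have e : 4 * Real.pi / 3 * K * r ^ 3 / b r ^ 3
          = 4 * Real.pi / 3 * (K / b r ^ 3) * r ^ 3 := by ring
      rw [e] at hmass
      refine ⟨?_, hρ.trans hη, ?_, ?_⟩
      · rw [ElasticBall.IsStretchProfile.delta_eq hK hr, h.eta_eq hβ hK hr,
          ElasticBall.strictlyHyperbolicAt_iff lam mu (by positivity) (by positivity),
          ElasticBall.radStretch_one_div ha hb, ElasticBall.tanStretch_one_div_pow_three hb]
        exact hyp.trans_le (ElasticBall.stretchHyp_mono hmu hbulk hβ hβb.le hba.le)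
      · rw [hmass]
        have := max_lt hρ hK1
        gcongr
      · rw [hmass]
        gcongr
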